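/- For an integer $N\ge 0$ let $U_N$ be the $2N$-dimensional real vector space of loops spanned by $\cos(k\theta)/\sqrt{k\pi}$, $\sin(k\theta)/\sqrt{k\pi}$, $1\le k\le N$, identified with $\mathbb R^{2N}$ by means of this basis, and carrying Lebesgue measure. Let $\omega(f,g)=\int_0^{2\pi} f(\theta)g'(\theta)\,d\theta$, and let $\tau(f,g)=e^{i\omega(f,g)}$, a continuous $U(1)$-valued $2$-cocycle on $U_N$. Let $U_N$ act on $C_0(U_N)$ by $(g.f)(x)=f(x-g)$ and on $L^2(U_N)$ by $[\rho_g\varphi](x)=\varphi(x-g)\,\tau(g,x)$, and let $C_0(U_N)$ act on $L^2(U_N)$ by pointwise multiplication $\pi$. Then $\rho_g\rho_h=\tau(g,h)\rho_{g+h}$ and $\rho_g\pi(f)\rho_g^{-1}=\pi(g.f)$, i.e. $(\pi,\rho)$ is a $\tau$-twisted covariant representation. Let $U_N\ltimes_\tau C_0(U_N)$ be the twisted crossed product: the completion of $C_c(U_N,C_0(U_N))$, with product $(f_1*f_2)(g)=\int f_1(h)\,(h.f_2(g-h))\,\tau(h,g-h)\,dh$ and involution $f^*(g)=\overline{\tau(g,-g)}\;g.(f(-g)^*)$,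 in the norm $\|f\|=\sup\|(\pi'\rtimes\rho')(f)\|$ over all $\tau$-twisted covariant representations $(\pi',\rho')$ of $(U_N,C_0(U_N))$ on Hilbert spaces, where $(\pi'\rtimes\rho')(f)=\int\pi'(f(g))\rho'_g\,dg$. (1) For every $N$ there is an isomorphism of $C^*$-algebras $\Phi_N\colon U_N\ltimes_\tau C_0(U_N)\to\mathcal K(L^2(U_N))$ induced by the representation above, i.e. $\Phi_N(f)=\int\pi(f(g))\rho_g\,dg$ for $f\in C_c(U_N,C_0(U_N))$. (2) Let $\Omega\in L^2(U_1)$, $\Omega(x)=\pi^{-1/2}e^{-|x|^2/2}$, be the lowest weight unit vector, $P=\Omega\otimes\Omega^*$ the rank-one projection onto its span, and identify $L^2(U_{N+1})=L^2(U_N)\otimes L^2(U_1)$ by splitting off the last pair of coordinates. For every $N$ there is a (unique) $*$-homomorphism $i_N\colon U_N\ltimes_\tau C_0(U_N)\to U_{N+1}\ltimes_\tau C_0(U_{N+1})$ with $\Phi_{N+1}(i_N(a))=\Phi_N(a)\otimes P$ for all $a$. (3) Let $L^2(\Omega T_0)$ be the Hilbert space inductive limit of $L^2(U_0)\to L^2(U_1)\to\cdots$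 along the isometries $\varphi\mapsto\varphi\otimes\Omega$, with canonical isometries $J_N\colon L^2(U_N)\to L^2(\Omega T_0)$, and let $\Omega T_0\ltimes_\tau C_0(\Omega T_0)$ be the inductive limit, in the category of $C^*$-algebras and $*$-homomorphisms, of the sequence $\bigl(U_N\ltimes_\tau C_0(U_N),\,i_N\bigr)$. Then $\Omega T_0\ltimes_\tau C_0(\Omega T_0)\cong\mathcal K(L^2(\Omega T_0))$; more precisely, $\mathcal K(L^2(\Omega T_0))$ with the maps $a\mapsto J_N\,\Phi_N(a)\,J_N^*$ is that inductive limit. -/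

import Mathlib

open MeasureTheory
open scoped ENNReal ZeroAtInfty CompactlySupported

set_option linter.unusedSectionVars false

noncomputable section

namespace TwistedCrossed

/-- A (strongly continuous) action of the abelian group `G` on the C⋆-algebra `A` by
`*`-automorphisms, together with a continuous normalized `U(1)`-valued 2-cocycle on `G`. -/
structure TwistedDynamics (G A : Type) [AddCommGroup G] [TopologicalSpace G]
    [NonUnitalCStarAlgebra A] where
  act : G → A ≃⋆ₐ[ℂ] A
  act_zero : ∀ a, act 0 a = a
  act_add : ∀ g h a, act (g + h) a = act g (act h a)
  act_continuous : ∀ a, Continuous fun g => act g a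
  coc : G → G → Circle
  coc_continuous : Continuous fun p : G × G => coc p.1 p.2
  coc_zero_left : ∀ g, coc 0 g = 1
  coc_zero_right : ∀ g, coc g 0 = 1
  coc_assoc : ∀ g h k, coc g h * coc (g + h) k = coc g (h + k) * coc h k

section dynamics

variable {G A : Type} [AddCommGroup G] [TopologicalSpace G] [NonUnitalCStarAlgebra A]

namespace TwistedDynamics

variable (S : TwistedDynamics G A)

lemma norm_act (g : G) (a : A) : ‖S.act g a‖ = ‖a‖ :=
  NonUnitalStarAlgHom.norm_map (S.act g) (S.act g).injective a

/-- joint continuity of the action -/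
lemma act_continuous₂ : Continuous fun p : G × A => S.act p.1 p.2 := by
  rw [continuous_iff_continuousAt]
  rintro ⟨g₀, a₀⟩
  rw [ContinuousAt, tendsto_iff_norm_sub_tendsto_zero]
  have h1 : Filter.Tendsto (fun p : G × A => ‖p.2 - a₀‖ + ‖S.act p.1 a₀ - S.act g₀ a₀‖)
      (nhds (g₀, a₀)) (nhds 0) := by
    have : Continuous fun p : G × A => ‖p.2 - a₀‖ + ‖S.act p.1 a₀ - S.act g₀ a₀‖ := by
      have := (S.act_continuous a₀).comp (continuous_fst (X := G) (Y := A))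
      simp only [Function.comp_def] at this
      fun_prop
    simpa using this.tendsto (g₀, a₀)
  refine squeeze_zero (fun _ => norm_nonneg _) (fun p => ?_) h1
  calc ‖S.act p.1 p.2 - S.act g₀ a₀‖
      = ‖S.act p.1 (p.2 - a₀) + (S.act p.1 a₀ - S.act g₀ a₀)‖ := by rw [map_sub]; abel_nf
    _ ≤ _ := (norm_add_le _ _).trans (by rw [S.norm_act])

lemma continuous_act {X : Type*} [TopologicalSpace X] {u : X → G} {v : X → A}
    (hu : Continuous u) (hv : Continuous v) : Continuous fun x => S.act (u x) (v x) :=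
  S.act_continuous₂.comp (hu.prodMk hv)

lemma continuous_coc {X : Type*} [TopologicalSpace X] {u v : X → G}
    (hu : Continuous u) (hv : Continuous v) :
    Continuous fun x => (S.coc (u x) (v x) : ℂ) :=
  continuous_subtype_val.comp (S.coc_continuous.comp (hu.prodMk hv))

lemma coc_neg_comm (g : G) : S.coc (-g) g = S.coc g (-g) := by
  have := S.coc_assoc (-g) g (-g)
  simpa [S.coc_zero_left, S.coc_zero_right] using this

/-- The involution `f^*(g) = conj σ(g, -g) • g.(f(-g)^*)` on `C_c(G, A)`. -/
def inv [IsTopologicalAddGroup G] (f : C_c(G, A)) : C_c(G, A) where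
  toFun g := (starRingEnd ℂ (S.coc g (-g) : ℂ)) • S.act g (star (f (-g)))
  continuous_toFun := by
    have h1 := S.continuous_coc continuous_id (continuous_neg (G := G))
    have h2 := S.continuous_act continuous_id
      (continuous_star.comp (f.continuous.comp (continuous_neg (G := G))))
    exact (Complex.continuous_conj.comp h1).smul h2
  hasCompactSupport' := by
    have h0 : HasCompactSupport fun g : G => f (-g) :=
      f.hasCompactSupport.comp_homeomorph (Homeomorph.neg G)
    refine h0.mono fun g hg => ?_
    simp only [Function.mem_support] at hg ⊢
    contrapose! hg
    simp [hg]

end TwistedDynamics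

end dynamics

section conv

variable {G A : Type} [AddCommGroup G] [TopologicalSpace G] [IsTopologicalAddGroup G]
  [LocallyCompactSpace G] [SecondCountableTopology G] [T2Space G] [MeasureSpace G] [BorelSpace G]
  [(volume : Measure G).IsAddHaarMeasure] [NonUnitalCStarAlgebra A]

namespace TwistedDynamics

variable (S : TwistedDynamics G A)

/-- The integrand of the twisted convolution. -/
def convIntegrand (f₁ f₂ : C_c(G, A)) (g h : G) : A :=
  (S.coc h (g - h) : ℂ) • (f₁ h * S.act h (f₂ (g - h)))

lemma convIntegrand_continuous (f₁ f₂ : C_c(G, A)) :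
    Continuous (S.convIntegrand f₁ f₂).uncurry := by
  have h1 := S.continuous_coc (X := G × G) (u := fun p => p.2) (v := fun p => p.1 - p.2)
    (by fun_prop) (by fun_prop)
  have h2 := S.continuous_act (X := G × G) (u := fun p => p.2) (v := fun p => f₂ (p.1 - p.2))
    (by fun_prop) (f₂.continuous.comp (by fun_prop))
  have h3 : Continuous fun p : G × G => f₁ p.2 := f₁.continuous.comp continuous_snd
  exact h1.smul (h3.mul h2)

lemma convIntegrand_eq_zero (f₁ f₂ : C_c(G, A)) (g h : G) (hh : h ∉ tsupport f₁) :
    S.convIntegrand f₁ f₂ g h = 0 := by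
  simp [convIntegrand, image_eq_zero_of_notMem_tsupport hh]

/-- The twisted convolution product on `C_c(G, A)`. -/
def conv (f₁ f₂ : C_c(G, A)) : C_c(G, A) where
  toFun g := ∫ h, S.convIntegrand f₁ f₂ g h
  continuous_toFun := by
    have h := continuous_parametric_integral_of_continuous (μ := (volume : Measure G))
      (S.convIntegrand_continuous f₁ f₂) f₁.hasCompactSupport.isCompact
    refine h.congr fun g => ?_
    exact setIntegral_eq_integral_of_forall_compl_eq_zero
      fun h hh => S.convIntegrand_eq_zero f₁ f₂ g h hh
  hasCompactSupport' := by
    refine HasCompactSupport.intro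
      (f₁.hasCompactSupport.isCompact.add f₂.hasCompactSupport.isCompact) fun g hg => ?_
    have : S.convIntegrand f₁ f₂ g = 0 := by
      funext h
      by_cases h1 : h ∈ tsupport f₁
      · by_cases h2 : g - h ∈ tsupport f₂
        · exact absurd (Set.add_mem_add h1 h2) (by simpa using hg)
        · simp [convIntegrand, image_eq_zero_of_notMem_tsupport h2]
      · exact S.convIntegrand_eq_zero f₁ f₂ g h h1
    simp [this]

lemma conv_apply (f₁ f₂ : C_c(G, A)) (g : G) :
    S.conv f₁ f₂ g = ∫ h, (S.coc h (g - h) : ℂ) • (f₁ h * S.act h (f₂ (g - h))) := rfl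

/-- A `σ`-twisted covariant representation on a Hilbert space. -/
structure CovRep (S : TwistedDynamics G A) where
  H : Type
  [instNormed : NormedAddCommGroup H]
  [instInner : InnerProductSpace ℂ H]
  [instComplete : CompleteSpace H]
  π : A →⋆ₙₐ[ℂ] (H →L[ℂ] H)
  ρ : G → H ≃ₗᵢ[ℂ] H
  ρ_continuous : ∀ v, Continuous fun g => ρ g v
  ρ_mul : ∀ g h v, ρ g (ρ h v) = (S.coc g h : ℂ) • ρ (g + h) v
  covariant : ∀ g a v, ρ g (π a v) = π (S.act g a) (ρ g v)

attribute [instance] CovRep.instNormed CovRep.instInner CovRep.instComplete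

namespace CovRep

variable {S} (r : CovRep S)

lemma norm_π_le (a : A) : ‖r.π a‖ ≤ ‖a‖ := NonUnitalStarAlgHom.norm_apply_le r.π a

lemma π_continuous : Continuous r.π :=
  AddMonoidHomClass.continuous_of_bound r.π 1 (by simpa using r.norm_π_le)

lemma ρ_continuous₂ : Continuous fun p : G × r.H => r.ρ p.1 p.2 := by
  rw [continuous_iff_continuousAt]
  rintro ⟨g₀, a₀⟩
  rw [ContinuousAt, tendsto_iff_norm_sub_tendsto_zero]
  have h1 : Filter.Tendsto (fun p : G × r.H => ‖p.2 - a₀‖ + ‖r.ρ p.1 a₀ - r.ρ g₀ a₀‖)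
      (nhds (g₀, a₀)) (nhds 0) := by
    have : Continuous fun p : G × r.H => ‖p.2 - a₀‖ + ‖r.ρ p.1 a₀ - r.ρ g₀ a₀‖ := by
      have := (r.ρ_continuous a₀).comp (continuous_fst (X := G) (Y := r.H))
      simp only [Function.comp_def] at this
      fun_prop
    simpa using this.tendsto (g₀, a₀)
  refine squeeze_zero (fun _ => norm_nonneg _) (fun p => ?_) h1
  calc ‖r.ρ p.1 p.2 - r.ρ g₀ a₀‖
      = ‖r.ρ p.1 (p.2 - a₀) + (r.ρ p.1 a₀ - r.ρ g₀ a₀)‖ := by rw [map_sub]; abel_nf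
    _ ≤ _ := (norm_add_le _ _).trans (by rw [LinearIsometryEquiv.norm_map])

lemma ρ_zero (v : r.H) : r.ρ 0 v = v := by
  have h := r.ρ_mul 0 0 v
  rw [S.coc_zero_left, add_zero] at h
  simpa using h

lemma integrand_continuous (f : C_c(G, A)) (v : r.H) :
    Continuous fun g => r.π (f g) (r.ρ g v) :=
  (r.π_continuous.comp f.continuous).clm_apply (r.ρ_continuous v)

lemma integrand_support (f : C_c(G, A)) (v : r.H) :
    HasCompactSupport fun g => r.π (f g) (r.ρ g v) :=
  f.hasCompactSupport.mono fun g hg => by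
    simp only [Function.mem_support] at hg ⊢
    contrapose! hg
    simp [hg]

lemma integrand_integrable (f : C_c(G, A)) (v : r.H) :
    Integrable fun g => r.π (f g) (r.ρ g v) :=
  (r.integrand_continuous f v).integrable_of_hasCompactSupport (r.integrand_support f v)

lemma integrable_norm (f : C_c(G, A)) : Integrable fun g : G => ‖f g‖ :=
  (f.continuous.integrable_of_hasCompactSupport f.hasCompactSupport).norm

/-- The integrated form `(π ⋊ ρ)(f) v = ∫ π(f(g)) ρ_g v dg`. -/
def integrated (f : C_c(G, A)) : r.H →L[ℂ] r.H :=
  LinearMap.mkContinuous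
    { toFun := fun v => ∫ g, r.π (f g) (r.ρ g v)
      map_add' := fun v w => by
        simp only [map_add]
        exact integral_add (r.integrand_integrable f v) (r.integrand_integrable f w)
      map_smul' := fun c v => by
        simp only [map_smul, RingHom.id_apply]
        exact integral_smul c _ }
    (∫ g, ‖f g‖) fun v => by
      change ‖∫ g, r.π (f g) (r.ρ g v)‖ ≤ _
      rw [← integral_mul_const]
      refine norm_integral_le_of_norm_le ((integrable_norm f).mul_const _)
        (Filter.Eventually.of_forall fun g => ?_)
      calc ‖r.π (f g) (r.ρ g v)‖ ≤ ‖r.π (f g)‖ * ‖r.ρ g v‖ := ContinuousLinearMap.le_opNorm _ _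
        _ ≤ ‖f g‖ * ‖v‖ := by
          rw [LinearIsometryEquiv.norm_map]
          gcongr
          exact r.norm_π_le _

lemma integrated_apply (f : C_c(G, A)) (v : r.H) :
    r.integrated f v = ∫ g, r.π (f g) (r.ρ g v) := rfl

lemma norm_integrated_le (f : C_c(G, A)) : ‖r.integrated f‖ ≤ ∫ g, ‖f g‖ :=
  LinearMap.mkContinuous_norm_le _ (integral_nonneg fun _ => norm_nonneg _) _

lemma integrated_add (f₁ f₂ : C_c(G, A)) :
    r.integrated (f₁ + f₂) = r.integrated f₁ + r.integrated f₂ := by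
  ext v
  simp only [integrated_apply, add_apply, CompactlySupportedContinuousMap.add_apply, map_add]
  exact integral_add (r.integrand_integrable f₁ v) (r.integrand_integrable f₂ v)

lemma integrated_smul (c : ℂ) (f : C_c(G, A)) :
    r.integrated (c • f) = c • r.integrated f := by
  ext v
  simp only [integrated_apply, CompactlySupportedContinuousMap.smul_apply, map_smul,
    smul_apply]
  exact integral_smul c _

lemma integrated_zero : r.integrated 0 = 0 := by
  simpa using r.integrated_smul 0 0

/-- The integrated form turns twisted convolution into composition. -/
lemma integrated_conv (f₁ f₂ : C_c(G, A)) :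
    r.integrated (S.conv f₁ f₂) = r.integrated f₁ * r.integrated f₂ := by
  ext v
  rw [mul_apply_eq_comp, integrated_apply, integrated_apply]
  -- the left-hand side as a double integral
  have hL : ∀ g, r.π (S.conv f₁ f₂ g) (r.ρ g v)
      = ∫ h, r.π (S.convIntegrand f₁ f₂ g h) (r.ρ g v) := by
    intro g
    let L : A →L[ℂ] r.H :=
      (ContinuousLinearMap.apply ℂ r.H (r.ρ g v)).comp
        (⟨{ toFun := r.π, map_add' := map_add r.π, map_smul' := fun c a => by simp },
          r.π_continuous⟩ : A →L[ℂ] r.H →L[ℂ] r.H)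
    have hi : Integrable (S.convIntegrand f₁ f₂ g) := by
      refine Continuous.integrable_of_hasCompactSupport ?_ ?_
      · exact (S.convIntegrand_continuous f₁ f₂).comp (Continuous.prodMk_right g)
      · exact HasCompactSupport.intro f₁.hasCompactSupport.isCompact
          fun h hh => S.convIntegrand_eq_zero f₁ f₂ g h hh
    exact (L.integral_comp_comm hi).symm
  have hR : ∀ h, r.π (f₁ h) (r.ρ h (r.integrated f₂ v))
      = ∫ g, r.π (S.convIntegrand f₁ f₂ g h) (r.ρ g v) := by
    intro h
    let L : r.H →L[ℂ] r.H := (r.π (f₁ h)).comp (r.ρ h : r.H →L[ℂ] r.H)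
    have h1 : r.π (f₁ h) (r.ρ h (r.integrated f₂ v))
        = ∫ k, r.π (f₁ h) (r.ρ h (r.π (f₂ k) (r.ρ k v))) :=
      (L.integral_comp_comm (r.integrand_integrable f₂ v)).symm
    rw [h1, ← integral_sub_right_eq_self
      (fun k => r.π (f₁ h) (r.ρ h (r.π (f₂ k) (r.ρ k v)))) h]
    congr 1
    funext g
    rw [r.covariant, r.ρ_mul]
    simp only [add_sub_cancel, map_smul, TwistedDynamics.convIntegrand, map_mul,
      mul_apply_eq_comp, smul_apply]
  simp only [hL, hR]
  refine integral_integral_swap_of_hasCompactSupport ?_ ?_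
  · exact (r.π_continuous.comp (S.convIntegrand_continuous f₁ f₂)).clm_apply
      ((r.ρ_continuous v).comp continuous_fst)
  · refine HasCompactSupport.intro
      ((f₁.hasCompactSupport.isCompact.add f₂.hasCompactSupport.isCompact).prod
        f₁.hasCompactSupport.isCompact) ?_
    rintro ⟨g, h⟩ hgh
    have : S.convIntegrand f₁ f₂ g h = 0 := by
      by_cases h1 : h ∈ tsupport f₁
      · by_cases h2 : g - h ∈ tsupport f₂
        · exact absurd (Set.mk_mem_prod (by simpa using Set.add_mem_add h1 h2) h1) hgh
        · simp [convIntegrand, image_eq_zero_of_notMem_tsupport h2]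
      · exact S.convIntegrand_eq_zero f₁ f₂ g h h1
    simp [Function.uncurry, this]

lemma ρ_symm (g : G) (v : r.H) :
    (r.ρ g).symm v = (starRingEnd ℂ (S.coc g (-g) : ℂ)) • r.ρ (-g) v := by
  rw [LinearIsometryEquiv.symm_apply_eq, map_smul, r.ρ_mul, smul_smul]
  have : (starRingEnd ℂ (S.coc g (-g) : ℂ)) * (S.coc g (-g) : ℂ) = 1 := by
    rw [← Complex.normSq_eq_conj_mul_self]; simp
  rw [this, add_neg_cancel, r.ρ_zero, one_smul]

/-- The integrated form respects the involutions. -/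
lemma integrated_inv (f : C_c(G, A)) :
    r.integrated (S.inv f) = star (r.integrated f) := by
  rw [ContinuousLinearMap.star_eq_adjoint, ContinuousLinearMap.eq_adjoint_iff]
  intro v w
  have e1 : inner ℂ (r.integrated (S.inv f) v) w
      = ∫ g, inner ℂ (r.π (S.inv f g) (r.ρ g v)) w := by
    rw [← inner_conj_symm, integrated_apply, ← integral_inner (r.integrand_integrable _ v),
      ← integral_conj]
    simp only [inner_conj_symm]
  have e2 : inner ℂ v (r.integrated f w) = ∫ g, inner ℂ v (r.π (f (-g)) (r.ρ (-g) w)) := by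
    rw [integrated_apply, ← integral_inner (r.integrand_integrable _ w)]
    exact (integral_neg_eq_self (fun g => inner ℂ v (r.π (f g) (r.ρ g w))) volume).symm
  rw [e1, e2]
  congr 1
  funext g
  have h1 : S.inv f g = (starRingEnd ℂ (S.coc g (-g) : ℂ)) • S.act g (star (f (-g))) := rfl
  rw [h1, map_smul, smul_apply, ← r.covariant, inner_smul_left, starRingEnd_self_apply,
    LinearIsometryEquiv.inner_map_eq_flip, ρ_symm, inner_smul_right, map_star,
    ContinuousLinearMap.star_eq_adjoint, ContinuousLinearMap.adjoint_inner_left, ← mul_assoc]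
  have : (S.coc g (-g) : ℂ) * (starRingEnd ℂ (S.coc g (-g) : ℂ)) = 1 := by
    rw [Complex.mul_conj]; simp
  rw [this, one_mul]

end CovRep

/-! ### The crossed product -/

/-- The C⋆-algebra of bounded families of operators, indexed by all `σ`-twisted covariant
representations. -/
abbrev Universal (S : TwistedDynamics G A) : Type 1 :=
  lp (fun r : CovRep S => r.H →L[ℂ] r.H) ∞

/-- `f ↦ ((π ⋊ ρ)(f))`, over all covariant representations. -/
def universalRep (f : C_c(G, A)) : S.Universal :=
  ⟨fun r => r.integrated f, memℓp_infty ⟨∫ g, ‖f g‖, by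
    rintro _ ⟨r, rfl⟩
    exact r.norm_integrated_le f⟩⟩

lemma universalRep_apply (f : C_c(G, A)) (r : CovRep S) :
    S.universalRep f r = r.integrated f := rfl

/-- The image of the convolution algebra `C_c(G, A)` in the universal representation. -/
def universalRange : NonUnitalStarSubalgebra ℂ S.Universal where
  carrier := Set.range S.universalRep
  add_mem' := by
    rintro _ _ ⟨f₁, rfl⟩ ⟨f₂, rfl⟩
    exact ⟨f₁ + f₂, by ext1; funext r; exact r.integrated_add f₁ f₂⟩
  zero_mem' := ⟨0, by ext1; funext r; exact r.integrated_zero⟩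
  mul_mem' := by
    rintro _ _ ⟨f₁, rfl⟩ ⟨f₂, rfl⟩
    exact ⟨S.conv f₁ f₂, by ext1; funext r; exact r.integrated_conv f₁ f₂⟩
  smul_mem' := by
    rintro c _ ⟨f, rfl⟩
    exact ⟨c • f, by ext1; funext r; exact r.integrated_smul c f⟩
  star_mem' := by
    rintro _ ⟨f, rfl⟩
    exact ⟨S.inv f, by ext1; funext r; exact r.integrated_inv f⟩

/-- The (full) twisted crossed product `G ⋉_σ A`: the completion of the convolution `*`-algebra
`C_c(G, A)` in the norm `‖f‖ = sup ‖(π ⋊ ρ)(f)‖` over all `σ`-twisted covariant representations,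
realized as the closure of the image of `C_c(G, A)` in the universal representation. -/
def CrossedProduct : Type 1 := S.universalRange.topologicalClosure

instance : IsClosed (S.universalRange.topologicalClosure : Set S.Universal) :=
  S.universalRange.isClosed_topologicalClosure

instance : NonUnitalCStarAlgebra S.CrossedProduct :=
  (inferInstance : NonUnitalCStarAlgebra S.universalRange.topologicalClosure)

/-- The canonical map `C_c(G, A) → G ⋉_σ A`. -/
def ι (f : C_c(G, A)) : S.CrossedProduct :=
  (⟨S.universalRep f, subset_closure ⟨f, rfl⟩⟩ : S.universalRange.topologicalClosure)

lemma norm_ι (f : C_c(G, A)) : ‖S.ι f‖ = ⨆ r : CovRep S, ‖r.integrated f‖ := rfl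

lemma ι_conv (f₁ f₂ : C_c(G, A)) : S.ι (S.conv f₁ f₂) = S.ι f₁ * S.ι f₂ := by
  refine Subtype.ext ?_
  ext1; funext r; exact r.integrated_conv f₁ f₂

lemma ι_inv (f : C_c(G, A)) : S.ι (S.inv f) = star (S.ι f) := by
  refine Subtype.ext ?_
  ext1; funext r; exact r.integrated_inv f

lemma denseRange_ι : DenseRange S.ι := by
  intro x
  rw [Metric.mem_closure_iff]
  intro ε hε
  obtain ⟨_, ⟨f, rfl⟩, hf⟩ := Metric.mem_closure_iff.1 x.2 ε hε
  exact ⟨S.ι f, ⟨f, rfl⟩, hf⟩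


end TwistedDynamics
end conv

/-! ### Compact operators -/

section Compact

variable {H K : Type*} [NormedAddCommGroup H] [InnerProductSpace ℂ H] [CompleteSpace H]
  [NormedAddCommGroup K] [InnerProductSpace ℂ K] [CompleteSpace K]

lemma isCompactOperator_adjoint {T : H →L[ℂ] H} (hT : IsCompactOperator T) :
    IsCompactOperator (star T : H →L[ℂ] H) := by
  have hTT : IsCompactOperator (T * star T : H →L[ℂ] H) := hT.comp_clm (star T)
  have htb := (hTT.isCompact_closure_image_closedBall 1).totallyBounded.subset subset_closure
  change IsCompactOperator ((star T : H →L[ℂ] H) : H →ₗ[ℂ] H)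
  rw [isCompactOperator_iff_isCompact_closure_image_closedBall
    ((star T : H →L[ℂ] H) : H →ₗ[ℂ] H) zero_lt_one]
  refine TotallyBounded.isCompact_of_isClosed (TotallyBounded.closure ?_) isClosed_closure
  rw [Metric.totallyBounded_iff]
  intro ε hε
  -- a finite net consisting of images of points of the ball
  obtain ⟨t, ht, htf, hcov⟩ := Metric.finite_approx_of_totallyBounded htb (ε ^ 2 / 4)
    (by positivity)
  choose! s hs using (fun y hy => ht hy : ∀ y ∈ t, ∃ x ∈ Metric.closedBall (0 : H) 1,
    (T * star T : H →L[ℂ] H) x = y)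
  refine ⟨(fun y => (star T : H →L[ℂ] H) (s y)) '' t, htf.image _, ?_⟩
  rintro _ ⟨x, hx, rfl⟩
  obtain ⟨y, hy, hxy⟩ := Set.mem_iUnion₂.1 (hcov ⟨x, hx, rfl⟩)
  refine Set.mem_iUnion₂.2 ⟨_, ⟨y, hy, rfl⟩, ?_⟩
  obtain ⟨hsy, hsy'⟩ := hs y hy
  change dist ((star T : H →L[ℂ] H) x) ((star T : H →L[ℂ] H) (s y)) < ε
  rw [dist_eq_norm, ← map_sub]
  have h1 : ‖(star T : H →L[ℂ] H) (x - s y)‖ ^ 2 ≤ ‖(T * star T : H →L[ℂ] H) (x - s y)‖ * ‖x - s y‖ := by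
    have : ‖(star T : H →L[ℂ] H) (x - s y)‖ ^ 2
        = RCLike.re (inner ℂ ((T * star T : H →L[ℂ] H) (x - s y)) (x - s y)) := by
      rw [← inner_self_eq_norm_sq (𝕜 := ℂ), ContinuousLinearMap.star_eq_adjoint,
        ContinuousLinearMap.adjoint_inner_right]
      rfl
    rw [this]
    exact (RCLike.re_le_norm _).trans (norm_inner_le_norm _ _)
  have h2 : ‖(T * star T : H →L[ℂ] H) (x - s y)‖ < ε ^ 2 / 4 := by
    have h : (T * star T : H →L[ℂ] H) (s y) = y := hsy'
    rw [map_sub, h, ← dist_eq_norm]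
    exact hxy
  have h3 : ‖x - s y‖ ≤ 2 := by
    have e1 : ‖x‖ ≤ 1 := by simpa using hx
    have e2 : ‖s y‖ ≤ 1 := by simpa using hsy
    linarith [norm_sub_le x (s y)]
  have h4 : ‖(star T : H →L[ℂ] H) (x - s y)‖ ^ 2 < ε ^ 2 := by
    have h5 := norm_nonneg ((T * star T : H →L[ℂ] H) (x - s y))
    nlinarith [norm_nonneg (x - s y), pow_pos hε 2]
  exact lt_of_pow_lt_pow_left₀ 2 hε.le h4

variable (H) in
/-- The C⋆-algebra `𝒦(H)` of compact operators on the Hilbert space `H`. -/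
def compactOps : NonUnitalStarSubalgebra ℂ (H →L[ℂ] H) where
  carrier := {T : H →L[ℂ] H | IsCompactOperator T}
  add_mem' hS hT := IsCompactOperator.add hS hT
  zero_mem' := isCompactOperator_zero
  mul_mem' {S _} _ hT := IsCompactOperator.clm_comp hT S
  smul_mem' c _ hT := IsCompactOperator.smul hT c
  star_mem' hT := isCompactOperator_adjoint hT

instance : IsClosed (compactOps H : Set (H →L[ℂ] H)) := by
  have h : IsClosed {T : H →L[ℂ] H | IsCompactOperator T} := isClosed_setOfPred_isCompactOperator
  exact h


/-- Conjugation `T ↦ V T V^*` by an isometry `V : H → K`, as a map `𝒦(H) → 𝒦(K)`. -/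
def compactConj (V : H →ₗᵢ[ℂ] K) : compactOps H →⋆ₙₐ[ℂ] compactOps K where
  toFun T := ⟨V.toContinuousLinearMap ∘L (T : H →L[ℂ] H) ∘L
      ContinuousLinearMap.adjoint V.toContinuousLinearMap,
    ((show IsCompactOperator (T : H →L[ℂ] H) from T.2).comp_clm _).clm_comp _⟩
  map_smul' c T := by ext; simp
  map_zero' := by ext; simp
  map_add' S T := by ext; simp
  map_mul' S T := by
    ext x
    have h : ∀ y, ContinuousLinearMap.adjoint V.toContinuousLinearMap (V y) = y := fun y =>
      ext_inner_left ℂ fun z => by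
        rw [ContinuousLinearMap.adjoint_inner_right]
        exact V.inner_map_map z y
    simp [h]
  map_star' T := by
    ext1
    simp [ContinuousLinearMap.star_eq_adjoint, ContinuousLinearMap.adjoint_comp,
      ContinuousLinearMap.comp_assoc]

end Compact

/-! ### Inductive limits -/

section CStarLimit

universe u v w

/-- `(L, j)` is the inductive limit, in the category of C⋆-algebras and `*`-homomorphisms, of the
sequence `A 0 → A 1 → ⋯` with connecting maps `i n`. -/
def IsCStarInductiveLimit (A : ℕ → Type u) [∀ n, NonUnitalCStarAlgebra (A n)]
    (i : ∀ n, A n →⋆ₙₐ[ℂ] A (n + 1)) (L : Type v) [NonUnitalCStarAlgebra L]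
    (j : ∀ n, A n →⋆ₙₐ[ℂ] L) : Prop :=
  (∀ n a, j (n + 1) (i n a) = j n a) ∧
    ∀ (B : Type w) [NonUnitalCStarAlgebra B] (k : ∀ n, A n →⋆ₙₐ[ℂ] B),
      (∀ n a, k (n + 1) (i n a) = k n a) → ∃! f : L →⋆ₙₐ[ℂ] B, ∀ n a, f (j n a) = k n a

end CStarLimit

section HilbertLimit

variable {E : ℕ → Type} [∀ n, NormedAddCommGroup (E n)] [∀ n, InnerProductSpace ℂ (E n)]
  (V : ∀ n, E n →ₗᵢ[ℂ] E (n + 1))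

/-- Sequences `(x_n)` with `x_{n+1} = V_n x_n` for all large `n`. Modulo sequences which are
eventually zero, these form the algebraic direct limit of `E 0 → E 1 → ⋯`. -/
def Coherent : Submodule ℂ (∀ n, E n) where
  carrier := {x | ∀ᶠ n in Filter.atTop, x (n + 1) = V n (x n)}
  add_mem' hx hy := by
    filter_upwards [hx, hy] with n h1 h2
    simp [h1, h2]
  zero_mem' := by simp
  smul_mem' c x hx := by
    filter_upwards [hx] with n h1
    simp [h1]

/-- The space of eventually coherent sequences, to be given the limit seminorm (and not the
topology of pointwise convergence). -/
def PreLimit : Type := Coherent V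

instance PreLimit.addCommGroup : AddCommGroup (PreLimit V) := inferInstanceAs (AddCommGroup (Coherent V))

instance PreLimit.module : Module ℂ (PreLimit V) := inferInstanceAs (Module ℂ (Coherent V))

lemma PreLimit.inner_eventually (x y : PreLimit V) :
    ∃ c : ℂ, ∀ᶠ n in Filter.atTop, inner ℂ (x.1 n) (y.1 n) = c := by
  obtain ⟨n₀, h⟩ := Filter.eventually_atTop.1 (x.2.and y.2)
  refine ⟨inner ℂ (x.1 n₀) (y.1 n₀), Filter.eventually_atTop.2 ⟨n₀, fun n hn => ?_⟩⟩
  induction n, hn using Nat.le_induction with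
  | base => rfl
  | succ n hn ih =>
    obtain ⟨h1, h2⟩ := h n hn
    rw [h1, h2, LinearIsometry.inner_map_map, ih]

/-- The eventual value of `⟪x_n, y_n⟫`. -/
def PreLimit.innerLim (x y : PreLimit V) : ℂ := (PreLimit.inner_eventually V x y).choose

lemma PreLimit.innerLim_spec (x y : PreLimit V) :
    ∀ᶠ n in Filter.atTop, inner ℂ (x.1 n) (y.1 n) = PreLimit.innerLim V x y :=
  (PreLimit.inner_eventually V x y).choose_spec

instance PreLimit.core : PreInnerProductSpace.Core ℂ (PreLimit V) where
  inner := PreLimit.innerLim V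
  conj_inner_symm x y := by
    obtain ⟨n, h1, h2⟩ := ((innerLim_spec V x y).and (innerLim_spec V y x)).exists
    rw [← h1, ← h2, inner_conj_symm]
  re_inner_nonneg x := by
    obtain ⟨n, h1⟩ := (innerLim_spec V x x).exists
    rw [← h1]
    exact inner_self_nonneg
  add_left x y z := by
    obtain ⟨n, h1, h2, h3⟩ := ((innerLim_spec V (x + y) z).and
      ((innerLim_spec V x z).and (innerLim_spec V y z))).exists
    rw [← h1, ← h2, ← h3]
    exact inner_add_left _ _ _
  smul_left x y c := by
    obtain ⟨n, h1, h2⟩ := ((innerLim_spec V (c • x) y).and (innerLim_spec V x y)).exists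
    rw [← h1, ← h2]
    exact inner_smul_left _ _ _

instance PreLimit.seminormed : SeminormedAddCommGroup (PreLimit V) :=
  InnerProductSpace.Core.toSeminormedAddCommGroup (𝕜 := ℂ)

instance PreLimit.innerProductSpace : InnerProductSpace ℂ (PreLimit V) := InnerProductSpace.ofCore _

lemma PreLimit.inner_spec (x y : PreLimit V) :
    ∀ᶠ n in Filter.atTop, inner ℂ (x.1 n) (y.1 n) = inner ℂ x y :=
  PreLimit.innerLim_spec V x y

lemma PreLimit.norm_spec (x : PreLimit V) : ∀ᶠ n in Filter.atTop, ‖x.1 n‖ = ‖x‖ := by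
  filter_upwards [PreLimit.inner_spec V x x] with n h
  rw [norm_eq_sqrt_re_inner (𝕜 := ℂ), h, ← norm_eq_sqrt_re_inner]

/-- The Hilbert space inductive limit of `E 0 → E 1 → ⋯` along the isometries `V n`: the
completion of the algebraic direct limit. -/
abbrev HilbertLimit : Type := UniformSpace.Completion (PreLimit V)

/-- The sequence `0, …, 0, x, V_n x, V_{n+1} V_n x, …` starting with `x` in place `n`. -/
def seqFrom (n : ℕ) (x : E n) : ∀ m, E m
  | 0 => if h : n = 0 then h ▸ x else 0
  | m + 1 => if h : n = m + 1 then h ▸ x else V m (seqFrom n x m)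

lemma seqFrom_self (n : ℕ) (x : E n) : seqFrom V n x n = x := by
  cases n <;> simp [seqFrom]

lemma seqFrom_succ {n m : ℕ} (hm : n ≤ m) (x : E n) :
    seqFrom V n x (m + 1) = V m (seqFrom V n x m) := by
  have : n ≠ m + 1 := by omega
  simp [seqFrom, this]

lemma seqFrom_add (n : ℕ) (x y : E n) : seqFrom V n (x + y) = seqFrom V n x + seqFrom V n y := by
  funext m
  induction m with
  | zero =>
    by_cases h : n = 0
    · subst h; simp [seqFrom]
    · simp [seqFrom, h]
  | succ m ih =>
    by_cases h : n = m + 1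
    · subst h; simp [seqFrom]
    · simp [seqFrom, h, ih]

lemma seqFrom_smul (n : ℕ) (c : ℂ) (x : E n) : seqFrom V n (c • x) = c • seqFrom V n x := by
  funext m
  induction m with
  | zero =>
    by_cases h : n = 0
    · subst h; simp [seqFrom]
    · simp [seqFrom, h]
  | succ m ih =>
    by_cases h : n = m + 1
    · subst h; simp [seqFrom]
    · simp [seqFrom, h, ih]

lemma seqFrom_mem (n : ℕ) (x : E n) : seqFrom V n x ∈ Coherent V :=
  Filter.eventually_atTop.2 ⟨n, fun _ hm => seqFrom_succ V hm x⟩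

/-- The class of `x : E n` in the algebraic direct limit. -/
def preFrom (n : ℕ) (x : E n) : PreLimit V := ⟨seqFrom V n x, seqFrom_mem V n x⟩

lemma norm_preFrom (n : ℕ) (x : E n) : ‖preFrom V n x‖ = ‖x‖ := by
  obtain ⟨m, h1, h2⟩ := ((PreLimit.norm_spec V (preFrom V n x)).and
    (Filter.eventually_ge_atTop n)).exists
  rw [← h1]
  clear h1
  change ‖seqFrom V n x m‖ = ‖x‖
  induction m, h2 using Nat.le_induction with
  | base => rw [seqFrom_self]
  | succ m hm ih => rw [seqFrom_succ V hm, LinearIsometry.norm_map, ih]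

/-- The canonical isometry of `E n` into the limit. -/
def toHilbertLimit (n : ℕ) : E n →ₗᵢ[ℂ] HilbertLimit V where
  toFun x := (preFrom V n x : HilbertLimit V)
  map_add' x y := by
    rw [← UniformSpace.Completion.coe_add]
    congr 1
    exact Subtype.ext (seqFrom_add V n x y)
  map_smul' c x := by
    rw [RingHom.id_apply, ← UniformSpace.Completion.coe_smul]
    congr 1
    exact Subtype.ext (seqFrom_smul V n c x)
  norm_map' x := by
    change ‖(preFrom V n x : HilbertLimit V)‖ = _
    rw [UniformSpace.Completion.norm_coe, norm_preFrom]

lemma PreLimit.coe_eq_of_eventually {x y : PreLimit V}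
    (h : ∀ᶠ n in Filter.atTop, x.1 n = y.1 n) : (x : HilbertLimit V) = y := by
  rw [← sub_eq_zero, ← UniformSpace.Completion.coe_sub, ← norm_eq_zero,
    UniformSpace.Completion.norm_coe]
  obtain ⟨n, h1, h2⟩ := ((PreLimit.norm_spec V (x - y)).and h).exists
  rw [← h1, show (x - y).1 n = x.1 n - y.1 n from rfl, h2, sub_self, norm_zero]

lemma toHilbertLimit_succ (n : ℕ) (x : E n) :
    toHilbertLimit V (n + 1) (V n x) = toHilbertLimit V n x := by
  refine PreLimit.coe_eq_of_eventually V (Filter.eventually_atTop.2 ⟨n + 1, fun m hm => ?_⟩)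
  change seqFrom V (n + 1) (V n x) m = seqFrom V n x m
  induction m, hm using Nat.le_induction with
  | base => rw [seqFrom_self, seqFrom_succ V le_rfl, seqFrom_self]
  | succ m hm ih => rw [seqFrom_succ V hm, seqFrom_succ V (by omega), ih]

lemma dense_range_toHilbertLimit :
    Dense (⋃ n, Set.range (toHilbertLimit V n)) := by
  refine (UniformSpace.Completion.denseRange_coe (α := PreLimit V)).mono ?_
  rintro _ ⟨x, rfl⟩
  obtain ⟨n₀, h⟩ := Filter.eventually_atTop.1 x.2
  refine Set.mem_iUnion.2 ⟨n₀, x.1 n₀, ?_⟩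
  refine PreLimit.coe_eq_of_eventually V (Filter.eventually_atTop.2 ⟨n₀, fun m hm => ?_⟩)
  change seqFrom V n₀ (x.1 n₀) m = x.1 m
  induction m, hm using Nat.le_induction with
  | base => rw [seqFrom_self]
  | succ m hm ih => rw [seqFrom_succ V hm, ih, h m hm]

end HilbertLimit


/-! ### Multiplication operators on `L²` -/

section MulOp

variable {X : Type*} [TopologicalSpace X] [MeasurableSpace X] [OpensMeasurableSpace X]
  {μ : Measure X}

lemma memLp_bcf_mul (m : BoundedContinuousFunction X ℂ) (φ : Lp ℂ 2 μ) :
    MemLp (fun x => m x * φ x) 2 μ :=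
  MemLp.of_le_mul (c := ‖m‖) (Lp.memLp φ)
    (m.continuous.aestronglyMeasurable.mul (Lp.aestronglyMeasurable φ))
    (Filter.Eventually.of_forall fun x => by
      rw [norm_mul]
      gcongr
      exact m.norm_coe_le_norm x)

/-- Multiplication by a bounded continuous function, as an operator on `L²`. -/
def mulOp (m : BoundedContinuousFunction X ℂ) : Lp ℂ 2 μ →L[ℂ] Lp ℂ 2 μ :=
  LinearMap.mkContinuous
    { toFun := fun φ => (memLp_bcf_mul m φ).toLp _
      map_add' := fun φ ψ => by
        ext1
        filter_upwards [MemLp.coeFn_toLp (memLp_bcf_mul m (φ + ψ)),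
          MemLp.coeFn_toLp (memLp_bcf_mul m φ), MemLp.coeFn_toLp (memLp_bcf_mul m ψ),
          Lp.coeFn_add φ ψ, Lp.coeFn_add ((memLp_bcf_mul m φ).toLp _)
            ((memLp_bcf_mul m ψ).toLp _)] with x h1 h2 h3 h4 h5
        rw [h1, h5, Pi.add_apply, h2, h3, h4, Pi.add_apply, mul_add]
      map_smul' := fun c φ => by
        ext1
        filter_upwards [MemLp.coeFn_toLp (memLp_bcf_mul m (c • φ)),
          MemLp.coeFn_toLp (memLp_bcf_mul m φ),
          Lp.coeFn_smul c φ, Lp.coeFn_smul c ((memLp_bcf_mul m φ).toLp _)] with x h1 h2 h3 h4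
        rw [h1, RingHom.id_apply, h4, Pi.smul_apply, h2, h3, Pi.smul_apply, smul_eq_mul,
          smul_eq_mul]
        ring }
    ‖m‖ fun φ => by
      refine Lp.norm_le_mul_norm_of_ae_le_mul ?_
      filter_upwards [MemLp.coeFn_toLp (memLp_bcf_mul m φ)] with x h1
      change ‖(memLp_bcf_mul m φ).toLp _ x‖ ≤ _
      rw [h1, norm_mul]
      gcongr
      exact m.norm_coe_le_norm x

lemma mulOp_coe (m : BoundedContinuousFunction X ℂ) (φ : Lp ℂ 2 μ) :
    mulOp m φ =ᵐ[μ] fun x => m x * φ x := MemLp.coeFn_toLp (memLp_bcf_mul m φ)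

end MulOp

/-! ### The symplectic vector spaces `U_N` -/

/-- The space `U_N` spanned by the loops `cos kθ / √(kπ)`, `sin kθ / √(kπ)`, `1 ≤ k ≤ N`: the
coordinates of `x` are the coefficients `(x k).1` of `cos (k+1)θ / √((k+1)π)` and `(x k).2` of
`sin (k+1)θ / √((k+1)π)`. -/
abbrev U (N : ℕ) : Type := Fin N → ℝ × ℝ

/-- The loop `θ ↦ x(θ)` with coordinates `x`. -/
def loop {N : ℕ} (x : U N) (θ : ℝ) : ℝ :=
  ∑ k : Fin N, ((x k).1 * (Real.cos (((k : ℕ) + 1) * θ) / √(((k : ℕ) + 1) * Real.pi)) +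
    (x k).2 * (Real.sin (((k : ℕ) + 1) * θ) / √(((k : ℕ) + 1) * Real.pi)))

/-- The symplectic form `ω(x, y) = ∫ x(θ) y'(θ) dθ` over the circle. -/
def sympForm {N : ℕ} (x y : U N) : ℝ :=
  ∫ θ in (0 : ℝ)..(2 * Real.pi), loop x θ * deriv (loop y) θ

lemma integral_cos_int (z : ℤ) :
    ∫ θ in (0 : ℝ)..(2 * Real.pi), Real.cos (z * θ) = if z = 0 then 2 * Real.pi else 0 := by
  split_ifs with h
  · simp [h]
  · have hz : (z : ℝ) ≠ 0 := by exact_mod_cast h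
    rw [intervalIntegral.integral_comp_mul_left (fun θ => Real.cos θ) hz, integral_cos]
    have : Real.sin (z * (2 * Real.pi)) = 0 := by
      have := Real.sin_int_mul_pi (z * 2)
      push_cast at this
      rwa [← mul_assoc]
    simp [this]

lemma integral_sin_int (z : ℤ) : ∫ θ in (0 : ℝ)..(2 * Real.pi), Real.sin (z * θ) = 0 := by
  by_cases h : z = 0
  · simp [h]
  · have hz : (z : ℝ) ≠ 0 := by exact_mod_cast h
    rw [intervalIntegral.integral_comp_mul_left (fun θ => Real.sin θ) hz, integral_sin]
    have : Real.cos (z * (2 * Real.pi)) = 1 := Real.cos_int_mul_two_pi z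
    simp [this]

lemma hasDerivAt_loop {N : ℕ} (y : U N) (θ : ℝ) :
    HasDerivAt (loop y) (∑ k : Fin N,
      ((y k).1 * (-Real.sin (((k : ℕ) + 1) * θ) * ((k : ℕ) + 1) / √(((k : ℕ) + 1) * Real.pi)) +
        (y k).2 * (Real.cos (((k : ℕ) + 1) * θ) * ((k : ℕ) + 1) / √(((k : ℕ) + 1) * Real.pi))))
      θ := by
  unfold loop
  refine HasDerivAt.fun_sum fun k _ => ?_
  have h0 : HasDerivAt (fun θ : ℝ => ((k : ℕ) + 1 : ℝ) * θ) ((k : ℕ) + 1 : ℝ) θ := by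
    simpa using (hasDerivAt_id θ).const_mul ((k : ℕ) + 1 : ℝ)
  exact ((h0.cos.div_const _).const_mul _).add ((h0.sin.div_const _).const_mul _)

/-- In coordinates, `ω` is the standard symplectic form. -/
lemma sympForm_eq {N : ℕ} (x y : U N) :
    sympForm x y = ∑ k : Fin N, ((x k).1 * (y k).2 - (x k).2 * (y k).1) := by
  have hcc : ∀ a b : ℕ, ∫ θ in (0 : ℝ)..(2 * Real.pi),
      Real.cos ((a + 1) * θ) * Real.cos ((b + 1) * θ) = if a = b then Real.pi else 0 := by
    intro a b
    have e : ∀ θ : ℝ, Real.cos ((a + 1) * θ) * Real.cos ((b + 1) * θ)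
        = (Real.cos (((a - b : ℤ) : ℝ) * θ) + Real.cos (((a + b + 2 : ℤ) : ℝ) * θ)) * (1 / 2) := by
      intro θ
      push_cast
      rw [show ((a : ℝ) - b) * θ = (a + 1) * θ - (b + 1) * θ by ring,
        show ((a : ℝ) + b + 2) * θ = (a + 1) * θ + (b + 1) * θ by ring, Real.cos_sub, Real.cos_add]
      ring
    simp_rw [e]
    rw [intervalIntegral.integral_mul_const, intervalIntegral.integral_add
      (by apply Continuous.intervalIntegrable; fun_prop)
      (by apply Continuous.intervalIntegrable; fun_prop), integral_cos_int, integral_cos_int]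
    have h2 : (a + b + 2 : ℤ) ≠ 0 := by omega
    by_cases h : a = b
    · rw [if_pos (by omega), if_neg h2, if_pos h]; ring
    · have : (a - b : ℤ) ≠ 0 := by omega
      simp [h, this, h2]
  have hss : ∀ a b : ℕ, ∫ θ in (0 : ℝ)..(2 * Real.pi),
      Real.sin ((a + 1) * θ) * Real.sin ((b + 1) * θ) = if a = b then Real.pi else 0 := by
    intro a b
    have e : ∀ θ : ℝ, Real.sin ((a + 1) * θ) * Real.sin ((b + 1) * θ)
        = (Real.cos (((a - b : ℤ) : ℝ) * θ) - Real.cos (((a + b + 2 : ℤ) : ℝ) * θ)) * (1 / 2) := by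
      intro θ
      push_cast
      rw [show ((a : ℝ) - b) * θ = (a + 1) * θ - (b + 1) * θ by ring,
        show ((a : ℝ) + b + 2) * θ = (a + 1) * θ + (b + 1) * θ by ring, Real.cos_sub, Real.cos_add]
      ring
    simp_rw [e]
    rw [intervalIntegral.integral_mul_const, intervalIntegral.integral_sub
      (by apply Continuous.intervalIntegrable; fun_prop)
      (by apply Continuous.intervalIntegrable; fun_prop), integral_cos_int, integral_cos_int]
    have h2 : (a + b + 2 : ℤ) ≠ 0 := by omega
    by_cases h : a = b
    · rw [if_pos (by omega), if_neg h2, if_pos h]; ring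
    · have : (a - b : ℤ) ≠ 0 := by omega
      simp [h, this, h2]
  have hsc : ∀ a b : ℕ, ∫ θ in (0 : ℝ)..(2 * Real.pi),
      Real.sin ((a + 1) * θ) * Real.cos ((b + 1) * θ) = 0 := by
    intro a b
    have e : ∀ θ : ℝ, Real.sin ((a + 1) * θ) * Real.cos ((b + 1) * θ)
        = (Real.sin (((a - b : ℤ) : ℝ) * θ) + Real.sin (((a + b + 2 : ℤ) : ℝ) * θ)) * (1 / 2) := by
      intro θ
      push_cast
      rw [show ((a : ℝ) - b) * θ = (a + 1) * θ - (b + 1) * θ by ring,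
        show ((a : ℝ) + b + 2) * θ = (a + 1) * θ + (b + 1) * θ by ring, Real.sin_sub, Real.sin_add]
      ring
    simp_rw [e]
    rw [intervalIntegral.integral_mul_const, intervalIntegral.integral_add
      (by apply Continuous.intervalIntegrable; fun_prop)
      (by apply Continuous.intervalIntegrable; fun_prop), integral_sin_int, integral_sin_int]
    simp
  unfold sympForm
  simp_rw [fun θ => (hasDerivAt_loop y θ).deriv, loop, Finset.sum_mul_sum]
  rw [intervalIntegral.integral_finsetSum
    (fun j _ => by apply Continuous.intervalIntegrable; fun_prop)]
  refine Finset.sum_congr rfl fun j _ => ?_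
  rw [intervalIntegral.integral_finsetSum
    (fun j _ => by apply Continuous.intervalIntegrable; fun_prop)]
  have key : ∀ k : Fin N, (∫ θ in (0 : ℝ)..(2 * Real.pi),
      ((x j).1 * (Real.cos (((j : ℕ) + 1) * θ) / √(((j : ℕ) + 1) * Real.pi)) +
        (x j).2 * (Real.sin (((j : ℕ) + 1) * θ) / √(((j : ℕ) + 1) * Real.pi))) *
      ((y k).1 * (-Real.sin (((k : ℕ) + 1) * θ) * ((k : ℕ) + 1) / √(((k : ℕ) + 1) * Real.pi)) +
        (y k).2 * (Real.cos (((k : ℕ) + 1) * θ) * ((k : ℕ) + 1) / √(((k : ℕ) + 1) * Real.pi))))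
      = if j = k then (x j).1 * (y j).2 - (x j).2 * (y j).1 else 0 := by
    intro k
    set A : ℝ := ((k : ℕ) + 1) / (√(((j : ℕ) + 1) * Real.pi) * √(((k : ℕ) + 1) * Real.pi)) with hA
    have e : ∀ θ : ℝ,
      ((x j).1 * (Real.cos (((j : ℕ) + 1) * θ) / √(((j : ℕ) + 1) * Real.pi)) +
        (x j).2 * (Real.sin (((j : ℕ) + 1) * θ) / √(((j : ℕ) + 1) * Real.pi))) *
      ((y k).1 * (-Real.sin (((k : ℕ) + 1) * θ) * ((k : ℕ) + 1) / √(((k : ℕ) + 1) * Real.pi)) +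
        (y k).2 * (Real.cos (((k : ℕ) + 1) * θ) * ((k : ℕ) + 1) / √(((k : ℕ) + 1) * Real.pi)))
      = (((x j).1 * (y k).2 * A) * (Real.cos (((j : ℕ) + 1) * θ) * Real.cos (((k : ℕ) + 1) * θ)) -
        ((x j).2 * (y k).1 * A) * (Real.sin (((j : ℕ) + 1) * θ) * Real.sin (((k : ℕ) + 1) * θ))) +
        (((x j).2 * (y k).2 * A) * (Real.sin (((j : ℕ) + 1) * θ) * Real.cos (((k : ℕ) + 1) * θ)) -
        ((x j).1 * (y k).1 * A) *
          (Real.sin (((k : ℕ) + 1) * θ) * Real.cos (((j : ℕ) + 1) * θ))) := by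
      intro θ
      rw [hA]
      ring
    simp_rw [e]
    rw [intervalIntegral.integral_add (by apply Continuous.intervalIntegrable; fun_prop)
      (by apply Continuous.intervalIntegrable; fun_prop),
      intervalIntegral.integral_sub (by apply Continuous.intervalIntegrable; fun_prop)
      (by apply Continuous.intervalIntegrable; fun_prop),
      intervalIntegral.integral_sub (by apply Continuous.intervalIntegrable; fun_prop)
      (by apply Continuous.intervalIntegrable; fun_prop)]
    simp only [intervalIntegral.integral_const_mul, hcc, hss, hsc]
    by_cases h : j = k
    · subst h
      have hpos : (0 : ℝ) < ((j : ℕ) + 1) * Real.pi := by positivity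
      have hA1 : A * Real.pi = 1 := by
        rw [hA, Real.mul_self_sqrt hpos.le]
        field_simp
      simp only [if_true]
      linear_combination ((x j).1 * (y j).2 - (x j).2 * (y j).1) * hA1
    · have : (j : ℕ) ≠ k := fun h' => h (Fin.ext h')
      simp [h, this]
  simp_rw [key]
  simp

lemma sympForm_continuous {N : ℕ} : Continuous fun p : U N × U N => sympForm p.1 p.2 := by
  simp_rw [sympForm_eq]
  fun_prop

lemma sympForm_add_left {N : ℕ} (x y z : U N) : sympForm (x + y) z = sympForm x z + sympForm y z := by
  simp only [sympForm_eq, Pi.add_apply, Prod.fst_add, Prod.snd_add, ← Finset.sum_add_distrib]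
  exact Finset.sum_congr rfl fun _ _ => by ring

lemma sympForm_neg_swap {N : ℕ} (x y : U N) : sympForm y x = -sympForm x y := by
  simp only [sympForm_eq, ← Finset.sum_neg_distrib]
  exact Finset.sum_congr rfl fun _ _ => by ring

lemma sympForm_add_right {N : ℕ} (x y z : U N) : sympForm x (y + z) = sympForm x y + sympForm x z := by
  rw [sympForm_neg_swap, sympForm_add_left, sympForm_neg_swap y x, sympForm_neg_swap z x]
  ring

lemma sympForm_zero_left {N : ℕ} (x : U N) : sympForm 0 x = 0 := by simp [sympForm_eq]

lemma sympForm_zero_right {N : ℕ} (x : U N) : sympForm x 0 = 0 := by simp [sympForm_eq]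

/-- The 2-cocycle `τ(x, y) = exp(i ω(x, y))`. -/
def tau {N : ℕ} (x y : U N) : Circle := Circle.exp (sympForm x y)

lemma tau_continuous {N : ℕ} : Continuous fun p : U N × U N => tau p.1 p.2 :=
  Circle.exp.continuous.comp sympForm_continuous


/-! ### The dynamical system `(U_N, C_0(U_N), τ)` and its representation on `L²(U_N)` -/

/-- The translation `(g.f)(x) = f(x - g)` on `C_0(U_N)`. -/
def shiftFun {N : ℕ} (g : U N) (f : C₀(U N, ℂ)) : C₀(U N, ℂ) where
  toFun x := f (x - g)
  continuous_toFun := f.continuous.comp (by fun_prop)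
  zero_at_infty' := f.zero_at_infty'.comp (Homeomorph.subRight g).isClosedEmbedding.tendsto_cocompact

lemma shiftFun_apply {N : ℕ} (g : U N) (f : C₀(U N, ℂ)) (x : U N) :
    shiftFun g f x = f (x - g) := rfl

/-- Translation by `g` as a `*`-automorphism of `C_0(U_N)`. -/
def shift {N : ℕ} (g : U N) : C₀(U N, ℂ) ≃⋆ₐ[ℂ] C₀(U N, ℂ) where
  toFun := shiftFun g
  invFun := shiftFun (-g)
  left_inv f := by ext x; simp [shiftFun_apply]
  right_inv f := by ext x; simp [shiftFun_apply]
  map_mul' _ _ := rfl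
  map_add' _ _ := rfl
  map_star' _ := rfl
  map_smul' _ _ := rfl

lemma shift_apply {N : ℕ} (g : U N) (f : C₀(U N, ℂ)) (x : U N) : shift g f x = f (x - g) := rfl

lemma shift_continuous {N : ℕ} (f : C₀(U N, ℂ)) : Continuous fun g => shift g f := by
  have huc : UniformContinuous f := ZeroAtInftyContinuousMap.uniformContinuous f
  rw [Metric.continuous_iff]
  intro g₀ ε hε
  obtain ⟨δ, hδ, h⟩ := Metric.uniformContinuous_iff.1 huc (ε / 2) (by positivity)
  refine ⟨δ, hδ, fun g hg => ?_⟩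
  rw [← ZeroAtInftyContinuousMap.dist_toBCF_eq_dist]
  refine lt_of_le_of_lt ?_ (half_lt_self hε)
  refine (BoundedContinuousFunction.dist_le (by positivity)).2 fun x => ?_
  refine (h ?_).le
  simpa [dist_eq_norm, norm_sub_rev] using hg


lemma tau_coe_continuous {N : ℕ} : Continuous fun p : U N × U N => (tau p.1 p.2 : ℂ) :=
  continuous_subtype_val.comp tau_continuous

lemma tau_coe_continuous_left {N : ℕ} (x : U N) : Continuous fun g : U N => (tau g x : ℂ) :=
  tau_coe_continuous.comp (f := fun g : U N => (g, x)) (by fun_prop)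

lemma tau_coe_continuous_right {N : ℕ} (g : U N) : Continuous fun x : U N => (tau g x : ℂ) :=
  tau_coe_continuous.comp (f := fun x : U N => (g, x)) (by fun_prop)

/-- The cocycle function `x ↦ τ(g, x)`. -/
def tauBCF {N : ℕ} (g : U N) : BoundedContinuousFunction (U N) ℂ :=
  BoundedContinuousFunction.ofNormedAddCommGroup (fun x => (tau g x : ℂ))
    (tau_coe_continuous_right g) 1 (fun x => (Circle.norm_coe (tau g x)).le)

lemma tauBCF_apply {N : ℕ} (g x : U N) : tauBCF g x = (tau g x : ℂ) := rfl

/-- The Hilbert space `L²(U_N)`, for Lebesgue measure in the symplectic coordinates. -/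
abbrev L2U (N : ℕ) : Type := Lp ℂ 2 (volume : Measure (U N))

/-- Translation `φ ↦ φ(· - g)` on `L²(U_N)`. -/
def trans {N : ℕ} (g : U N) : L2U N →ₗᵢ[ℂ] L2U N :=
  Lp.compMeasurePreservingₗᵢ ℂ (fun x => x - g) (measurePreserving_sub_right volume g)

lemma trans_coe {N : ℕ} (g : U N) (φ : L2U N) : trans g φ =ᵐ[volume] fun x => φ (x - g) :=
  Lp.coeFn_compMeasurePreserving φ (measurePreserving_sub_right volume g)

lemma trans_continuous {N : ℕ} (φ : L2U N) : Continuous fun g => trans g φ := by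
  let c : U N → C(U N, U N) := fun g => ⟨fun x => x - g, by fun_prop⟩
  have hc : Continuous c := by
    refine ContinuousMap.continuous_of_continuous_uncurry _ ?_
    change Continuous fun p : U N × U N => p.2 - p.1
    fun_prop
  exact Continuous.compMeasurePreservingLp (continuous_const (y := φ)) hc
    (fun g => measurePreserving_sub_right volume g) (by norm_num)

lemma norm_mulOp_tauBCF {N : ℕ} (g : U N) (φ : L2U N) : ‖mulOp (tauBCF g) φ‖ = ‖φ‖ := by
  rw [Lp.norm_def, Lp.norm_def]
  congr 1
  refine eLpNorm_congr_norm_ae ?_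
  filter_upwards [mulOp_coe (tauBCF g) φ] with x hx
  rw [hx, norm_mul, tauBCF_apply, Circle.norm_coe, one_mul]

lemma mulOp_tauBCF_continuous {N : ℕ} (φ : L2U N) :
    Continuous fun g => mulOp (tauBCF g) φ := by
  rw [continuous_iff_continuousAt]
  intro g₀
  rw [ContinuousAt, tendsto_iff_norm_sub_tendsto_zero]
  have hin : Continuous fun g => (inner ℂ (mulOp (tauBCF g) φ) (mulOp (tauBCF g₀) φ) : ℂ) := by
    have e : ∀ g, (inner ℂ (mulOp (tauBCF g) φ) (mulOp (tauBCF g₀) φ) : ℂ)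
        = ∫ x, (starRingEnd ℂ (tau g x : ℂ)) * (tau g₀ x : ℂ) * inner ℂ (φ x) (φ x) := by
      intro g
      rw [L2.inner_def]
      refine integral_congr_ae ?_
      filter_upwards [mulOp_coe (tauBCF g) φ, mulOp_coe (tauBCF g₀) φ] with x h1 h2
      rw [h1, h2, tauBCF_apply, tauBCF_apply]
      simp only [RCLike.inner_apply, map_mul]
      ring
    simp_rw [e]
    refine continuous_of_dominated (bound := fun x => ‖(inner ℂ (φ x) (φ x) : ℂ)‖) ?_ ?_ ?_ ?_
    · intro g
      refine AEStronglyMeasurable.mul (Continuous.aestronglyMeasurable ?_)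
        (L2.integrable_inner φ φ).aestronglyMeasurable
      exact (Complex.continuous_conj.comp (tauBCF g).continuous).mul (tauBCF g₀).continuous
    · exact fun g => Filter.Eventually.of_forall fun x => by
        rw [norm_mul, norm_mul, RCLike.norm_conj, Circle.norm_coe, Circle.norm_coe, one_mul,
          one_mul]
    · exact (L2.integrable_inner φ φ).norm
    · refine Filter.Eventually.of_forall fun x => ?_
      exact ((Complex.continuous_conj.comp (tau_coe_continuous_left x)).mul continuous_const).mul continuous_const
  have hsq : Filter.Tendsto (fun g => ‖mulOp (tauBCF g) φ - mulOp (tauBCF g₀) φ‖ ^ 2)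
      (nhds g₀) (nhds 0) := by
    have e : ∀ g, ‖mulOp (tauBCF g) φ - mulOp (tauBCF g₀) φ‖ ^ 2 = 2 * ‖φ‖ ^ 2 -
        2 * RCLike.re (inner ℂ (mulOp (tauBCF g) φ) (mulOp (tauBCF g₀) φ) : ℂ) := by
      intro g
      rw [norm_sub_sq (𝕜 := ℂ), norm_mulOp_tauBCF, norm_mulOp_tauBCF]
      ring
    simp_rw [e]
    have hc : Continuous fun g => 2 * ‖φ‖ ^ 2 -
        2 * RCLike.re (inner ℂ (mulOp (tauBCF g) φ) (mulOp (tauBCF g₀) φ) : ℂ) :=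
      continuous_const.sub (continuous_const.mul (RCLike.continuous_re.comp hin))
    have := hc.tendsto g₀
    rwa [inner_self_eq_norm_sq (𝕜 := ℂ), norm_mulOp_tauBCF, sub_self] at this
  have := (Real.continuous_sqrt.tendsto 0).comp hsq
  simpa [Function.comp_def, Real.sqrt_sq] using this

/-- Multiplication by `τ(g, ·)` as an isometry. -/
def modulate {N : ℕ} (g : U N) : L2U N →ₗᵢ[ℂ] L2U N :=
  ⟨(mulOp (tauBCF g) : L2U N →L[ℂ] L2U N).toLinearMap, norm_mulOp_tauBCF g⟩

/-- The projective action `[g.φ](x) = φ(x - g) τ(g, x)` of `U_N` on `L²(U_N)`. -/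
def twTrans {N : ℕ} (g : U N) : L2U N →ₗᵢ[ℂ] L2U N := (modulate g).comp (trans g)

lemma twTrans_eq {N : ℕ} (g : U N) (φ : L2U N) :
    twTrans g φ = mulOp (tauBCF g) (trans g φ) := rfl

lemma twTrans_coe {N : ℕ} (g : U N) (φ : L2U N) :
    twTrans g φ =ᵐ[volume] fun x => φ (x - g) * (tau g x : ℂ) := by
  filter_upwards [mulOp_coe (tauBCF g) (trans g φ), trans_coe g φ] with x h1 h2
  rw [twTrans_eq, h1, h2, tauBCF_apply, mul_comm]

lemma ae_sub {N : ℕ} (g : U N) {p : U N → Prop} (h : ∀ᵐ x, p x) : ∀ᵐ x, p (x - g) :=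
  (measurePreserving_sub_right volume g).quasiMeasurePreserving.ae h

lemma tau_mul_tau {N : ℕ} (g h x : U N) :
    (tau h (x - g) : ℂ) * (tau g x : ℂ) = (tau g h : ℂ) * (tau (g + h) x : ℂ) := by
  rw [← Circle.coe_mul, ← Circle.coe_mul, tau, tau, tau, tau, ← Circle.exp_add, ← Circle.exp_add]
  congr 2
  have h1 := sympForm_add_right h (x - g) g
  rw [sub_add_cancel] at h1
  have h2 := sympForm_neg_swap g h
  have h3 := sympForm_add_left g h x
  linarith

lemma twTrans_twTrans {N : ℕ} (g h : U N) (φ : L2U N) :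
    twTrans g (twTrans h φ) = (tau g h : ℂ) • twTrans (g + h) φ := by
  ext1
  filter_upwards [twTrans_coe g (twTrans h φ), ae_sub g (twTrans_coe h φ),
    Lp.coeFn_smul (tau g h : ℂ) (twTrans (g + h) φ), twTrans_coe (g + h) φ] with x h1 h2 h3 h4
  rw [h1, h2, h3, Pi.smul_apply, h4, smul_eq_mul, mul_assoc, tau_mul_tau, sub_sub]
  ring

lemma twTrans_zero {N : ℕ} (φ : L2U N) : twTrans 0 φ = φ := by
  ext1
  filter_upwards [twTrans_coe 0 φ] with x h1
  rw [h1, tau, sympForm_zero_left]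
  simp

lemma tau_neg_left {N : ℕ} (g : U N) : tau (-g) g = 1 := by
  have h1 := sympForm_add_left (-g) g g
  have h2 := sympForm_neg_swap g g
  rw [neg_add_cancel, sympForm_zero_left] at h1
  rw [tau, show sympForm (-g) g = 0 by linarith, Circle.exp_zero]

/-- `twTrans g` as a unitary operator. -/
def twUnitary {N : ℕ} (g : U N) : L2U N ≃ₗᵢ[ℂ] L2U N where
  toFun := twTrans g
  map_add' := map_add _
  map_smul' := map_smul _
  invFun := twTrans (-g)
  left_inv φ := by
    rw [twTrans_twTrans, neg_add_cancel, twTrans_zero, tau_neg_left]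
    simp
  right_inv φ := by
    have := tau_neg_left (-g)
    rw [neg_neg] at this
    rw [twTrans_twTrans, add_neg_cancel, twTrans_zero, this]
    simp
  norm_map' := (twTrans g).norm_map

lemma twUnitary_coe {N : ℕ} (g : U N) (φ : L2U N) :
    twUnitary g φ =ᵐ[volume] fun x => φ (x - g) * (tau g x : ℂ) := twTrans_coe g φ

lemma twTrans_continuous {N : ℕ} (φ : L2U N) : Continuous fun g => twTrans g φ := by
  rw [continuous_iff_continuousAt]
  intro g₀
  rw [ContinuousAt, tendsto_iff_norm_sub_tendsto_zero]
  have h1 : Filter.Tendsto (fun g => ‖trans g φ - trans g₀ φ‖ +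
      ‖mulOp (tauBCF g) (trans g₀ φ) - mulOp (tauBCF g₀) (trans g₀ φ)‖) (nhds g₀) (nhds 0) := by
    have hc : Continuous fun g => ‖trans g φ - trans g₀ φ‖ +
        ‖mulOp (tauBCF g) (trans g₀ φ) - mulOp (tauBCF g₀) (trans g₀ φ)‖ :=
      (((trans_continuous φ).sub continuous_const).norm).add
        (((mulOp_tauBCF_continuous (trans g₀ φ)).sub continuous_const).norm)
    simpa using hc.tendsto g₀
  refine squeeze_zero (fun _ => norm_nonneg _) (fun g => ?_) h1
  calc ‖twTrans g φ - twTrans g₀ φ‖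
      = ‖mulOp (tauBCF g) (trans g φ - trans g₀ φ) +
          (mulOp (tauBCF g) (trans g₀ φ) - mulOp (tauBCF g₀) (trans g₀ φ))‖ := by
        rw [map_sub, twTrans_eq, twTrans_eq]; abel_nf
    _ ≤ _ := (norm_add_le _ _).trans (by rw [norm_mulOp_tauBCF])

/-- Pointwise multiplication of `C_0(U_N)` on `L²(U_N)`. -/
def mulRep (N : ℕ) : C₀(U N, ℂ) →⋆ₙₐ[ℂ] (L2U N →L[ℂ] L2U N) where
  toFun f := mulOp f.toBCF
  map_smul' c f := by
    ext φ
    filter_upwards [mulOp_coe (c • f).toBCF φ, mulOp_coe f.toBCF φ,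
      Lp.coeFn_smul c (mulOp f.toBCF φ)] with x h1 h2 h3
    rw [h1]
    change _ = ((c • mulOp f.toBCF φ : L2U N) : U N → ℂ) x
    rw [h3, Pi.smul_apply, h2, smul_eq_mul, ← mul_assoc]
    rfl
  map_zero' := by
    ext φ
    filter_upwards [mulOp_coe (0 : C₀(U N, ℂ)).toBCF φ, Lp.coeFn_zero ℂ 2 volume] with x h1 h2
    rw [h1, zero_apply, h2]
    exact zero_mul _
  map_add' f g := by
    ext φ
    filter_upwards [mulOp_coe (f + g).toBCF φ, mulOp_coe f.toBCF φ, mulOp_coe g.toBCF φ,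
      Lp.coeFn_add (mulOp f.toBCF φ) (mulOp g.toBCF φ)] with x h1 h2 h3 h4
    rw [h1, add_apply, h4, Pi.add_apply, h2, h3, ← add_mul]
    rfl
  map_mul' f g := by
    ext φ
    filter_upwards [mulOp_coe (f * g).toBCF φ, mulOp_coe f.toBCF (mulOp g.toBCF φ),
      mulOp_coe g.toBCF φ] with x h1 h2 h3
    rw [h1, mul_apply_eq_comp, h2, h3, ← mul_assoc]
    rfl
  map_star' f := by
    rw [ContinuousLinearMap.star_eq_adjoint, ContinuousLinearMap.eq_adjoint_iff]
    intro φ ψ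
    rw [L2.inner_def, L2.inner_def]
    refine integral_congr_ae ?_
    filter_upwards [mulOp_coe (star f).toBCF φ, mulOp_coe f.toBCF ψ] with x h1 h2
    rw [h1, h2]
    simp only [RCLike.inner_apply, map_mul]
    have : (starRingEnd ℂ) ((star f).toBCF x) = f.toBCF x := star_star (f x)
    rw [this]
    ring

lemma mulRep_coe {N : ℕ} (f : C₀(U N, ℂ)) (φ : L2U N) :
    mulRep N f φ =ᵐ[volume] fun x => f x * φ x := mulOp_coe f.toBCF φ

lemma tau_cocycle {N : ℕ} (g h k : U N) :
    tau g h * tau (g + h) k = tau g (h + k) * tau h k := by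
  rw [tau, tau, tau, tau, ← Circle.exp_add, ← Circle.exp_add, sympForm_add_left,
    sympForm_add_right]
  congr 1
  ring

/-- The dynamical system `(U_N, C_0(U_N))` with the cocycle `τ`. -/
def loopSystem (N : ℕ) : TwistedDynamics (U N) C₀(U N, ℂ) where
  act := shift
  act_zero f := by ext x; simp [shift_apply]
  act_add g h f := by ext x; simp [shift_apply, sub_sub]
  act_continuous := shift_continuous
  coc := tau
  coc_continuous := tau_continuous
  coc_zero_left g := by simp [tau, sympForm_zero_left]
  coc_zero_right g := by simp [tau, sympForm_zero_right]
  coc_assoc := tau_cocycle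

/-- The `τ`-twisted covariant representation of `(U_N, C_0(U_N))` on `L²(U_N)`. -/
def stdRep (N : ℕ) : (loopSystem N).CovRep where
  H := L2U N
  π := mulRep N
  ρ := twUnitary
  ρ_continuous := twTrans_continuous
  ρ_mul := twTrans_twTrans
  covariant g f φ := by
    ext1
    filter_upwards [twUnitary_coe g (mulRep N f φ), ae_sub g (mulRep_coe f φ),
      mulRep_coe (shift g f) (twUnitary g φ), twUnitary_coe g φ] with x h1 h2 h3 h4
    change _ = (mulRep N (shift g f) (twUnitary g φ) : U N → ℂ) x
    rw [h1, h2, h3, h4, shift_apply, mul_assoc]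

/-! ### Exterior tensor products and the vacuum vector -/

/-- The first `M` coordinates of a point of `U_{M+N}`. -/
def fstPart {M N : ℕ} (z : U (M + N)) : U M := fun k => z (Fin.castAdd N k)

/-- The last `N` coordinates of a point of `U_{M+N}`. -/
def sndPart {M N : ℕ} (z : U (M + N)) : U N := fun k => z (Fin.natAdd M k)

lemma measurePreserving_parts (M N : ℕ) :
    MeasurePreserving (fun z : U (M + N) => ((fstPart z : U M), (sndPart z : U N)))
      volume (volume.prod volume) := by
  have h1 := (volume_measurePreserving_piCongrLeft (fun _ : Fin (M + N) => ℝ × ℝ)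
    finSumFinEquiv).symm
  have h2 := volume_measurePreserving_sumPiEquivProdPi (fun _ : Fin M ⊕ Fin N => ℝ × ℝ)
  have h3 := h2.comp h1
  have e : ((MeasurableEquiv.sumPiEquivProdPi fun _ : Fin M ⊕ Fin N => ℝ × ℝ) ∘
      (MeasurableEquiv.piCongrLeft (fun _ : Fin (M + N) => ℝ × ℝ) finSumFinEquiv).symm)
      = fun z : U (M + N) => ((fstPart z : U M), (sndPart z : U N)) := by
    funext z
    rfl
  rw [e] at h3
  exact h3

lemma fstPart_quasi (M N : ℕ) :
    Measure.QuasiMeasurePreserving (fstPart : U (M + N) → U M) volume volume :=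
  (Measure.quasiMeasurePreserving_fst).comp
    (measurePreserving_parts M N).quasiMeasurePreserving

lemma sndPart_quasi (M N : ℕ) :
    Measure.QuasiMeasurePreserving (sndPart : U (M + N) → U N) volume volume :=
  (Measure.quasiMeasurePreserving_snd).comp
    (measurePreserving_parts M N).quasiMeasurePreserving

lemma aesm_tensor {M N : ℕ} (φ : L2U M) (ψ : L2U N) :
    AEStronglyMeasurable (fun z : U (M + N) => φ (fstPart z) * ψ (sndPart z)) volume :=
  ((Lp.aestronglyMeasurable φ).comp_quasiMeasurePreserving (fstPart_quasi M N)).mul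
    ((Lp.aestronglyMeasurable ψ).comp_quasiMeasurePreserving (sndPart_quasi M N))

lemma eLpNorm_tensor {M N : ℕ} (φ : L2U M) (ψ : L2U N) :
    eLpNorm (fun z : U (M + N) => φ (fstPart z) * ψ (sndPart z)) 2 volume
      = eLpNorm φ 2 volume * eLpNorm ψ 2 volume := by
  have hφ := Lp.aestronglyMeasurable φ
  have hψ := Lp.aestronglyMeasurable ψ
  have key : ∫⁻ z : U (M + N), ‖φ (fstPart z) * ψ (sndPart z)‖ₑ ^ (2 : ℝ)
      = (∫⁻ x, ‖φ x‖ₑ ^ (2 : ℝ)) * ∫⁻ y, ‖ψ y‖ₑ ^ (2 : ℝ) := by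
    have hm : AEMeasurable (fun p : U M × U N => ‖φ p.1‖ₑ ^ (2 : ℝ) * ‖ψ p.2‖ₑ ^ (2 : ℝ))
        (volume.prod volume) :=
      ((hφ.enorm.pow_const _).comp_quasiMeasurePreserving
        Measure.quasiMeasurePreserving_fst).mul
        ((hψ.enorm.pow_const _).comp_quasiMeasurePreserving Measure.quasiMeasurePreserving_snd)
    rw [← lintegral_prod_mul (hφ.enorm.pow_const _) (hψ.enorm.pow_const _),
      ← (measurePreserving_parts M N).map_eq,
      lintegral_map' (by rw [(measurePreserving_parts M N).map_eq]; exact hm)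
        (measurePreserving_parts M N).aemeasurable]
    refine lintegral_congr fun z => ?_
    rw [enorm_mul, ENNReal.mul_rpow_of_nonneg _ _ (by norm_num)]
  have h2 : (2 : ℝ≥0∞) ≠ 0 := by norm_num
  have h2' : (2 : ℝ≥0∞) ≠ ∞ := by norm_num
  rw [eLpNorm_eq_lintegral_rpow_enorm_toReal h2 h2', eLpNorm_eq_lintegral_rpow_enorm_toReal h2 h2',
    eLpNorm_eq_lintegral_rpow_enorm_toReal h2 h2', ENNReal.toReal_ofNat, key,
    ENNReal.mul_rpow_of_nonneg _ _ (by norm_num)]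

lemma memLp_tensor {M N : ℕ} (φ : L2U M) (ψ : L2U N) :
    MemLp (fun z : U (M + N) => φ (fstPart z) * ψ (sndPart z)) 2 volume :=
  ⟨aesm_tensor φ ψ, by
    rw [eLpNorm_tensor]
    exact ENNReal.mul_lt_top (Lp.eLpNorm_lt_top φ) (Lp.eLpNorm_lt_top ψ)⟩

/-- The elementary tensor `(φ ⊗ ψ)(x, y) = φ(x) ψ(y)` under `L²(U_{M+N}) ≅ L²(U_M) ⊗ L²(U_N)`. -/
def tensor {M N : ℕ} (φ : L2U M) (ψ : L2U N) : L2U (M + N) := (memLp_tensor φ ψ).toLp _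

lemma tensor_coe {M N : ℕ} (φ : L2U M) (ψ : L2U N) :
    tensor φ ψ =ᵐ[volume] fun z => φ (fstPart z) * ψ (sndPart z) :=
  MemLp.coeFn_toLp (memLp_tensor φ ψ)

lemma norm_tensor {M N : ℕ} (φ : L2U M) (ψ : L2U N) : ‖tensor φ ψ‖ = ‖φ‖ * ‖ψ‖ := by
  rw [tensor, Lp.norm_toLp, eLpNorm_tensor, ENNReal.toReal_mul, Lp.norm_def, Lp.norm_def]

/-- The Gaussian `Ω(x) = π^{-1/2} exp(-|x|²/2)` on `U_1`. -/
def vacuumFun (x : U 1) : ℂ :=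
  ((√Real.pi)⁻¹ * Real.exp (-((x 0).1 ^ 2 + (x 0).2 ^ 2) / 2) : ℝ)

/-- The Schrödinger representation `ρ_{(a, b)} ψ(y) = exp(i(2by + ab)) ψ(y + a)` of `U_1` on
functions on the line. Its lowest weight vector is `y ↦ exp(-y²)`. -/
def schrodinger (g : U 1) (ψ : ℝ → ℂ) (y : ℝ) : ℂ :=
  Complex.exp (Complex.I * (2 * (g 0).2 * y + (g 0).1 * (g 0).2)) * ψ (y + (g 0).1)

/-- `Ω` is the matrix coefficient `(√2 / π) ⟪1, ρ_{-x} 1⟫` of the lowest weight vector `1` of the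
irreducible representation of `U_1`. -/
lemma vacuumFun_eq (x : U 1) :
    vacuumFun x = (√2 / Real.pi : ℝ) * ∫ y : ℝ, (starRingEnd ℂ) (Complex.exp (-(y : ℂ) ^ 2)) *
      schrodinger (-x) (fun y => Complex.exp (-(y : ℂ) ^ 2)) y := by
  set a := (x 0).1 with ha
  set b := (x 0).2 with hb
  have e : ∀ y : ℝ, (starRingEnd ℂ) (Complex.exp (-(y : ℂ) ^ 2)) *
      schrodinger (-x) (fun y => Complex.exp (-(y : ℂ) ^ 2)) y
      = Complex.exp ((-2 : ℂ) * (y : ℂ) ^ 2 + (2 * a - 2 * b * Complex.I) * y +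
        (Complex.I * (a * b) - a ^ 2)) := by
    intro y
    have h1 : (starRingEnd ℂ) (Complex.exp (-(y : ℂ) ^ 2)) = Complex.exp (-(y : ℂ) ^ 2) := by
      rw [← Complex.exp_conj]; simp
    rw [h1, schrodinger, ← Complex.exp_add, ← Complex.exp_add]
    congr 1
    simp only [Pi.neg_apply, Prod.fst_neg, Prod.snd_neg, ← ha, ← hb]
    push_cast
    ring
  simp_rw [e]
  rw [integral_cexp_quadratic (by norm_num), vacuumFun, ← ha, ← hb]
  have h1 : ((Real.pi : ℂ) / -(-2)) ^ (1 / 2 : ℂ) = ((√Real.pi / √2 : ℝ) : ℂ) := by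
    rw [← Real.sqrt_div Real.pi_pos.le, Real.sqrt_eq_rpow,
      Complex.ofReal_cpow (by positivity)]
    push_cast
    norm_num
  have h2 : (Complex.I * (a * b) - a ^ 2 -
      (2 * a - 2 * b * Complex.I) ^ 2 / (4 * (-2)) : ℂ) = ((-(a ^ 2 + b ^ 2) / 2 : ℝ) : ℂ) := by
    push_cast
    linear_combination ((b : ℂ) ^ 2 / 2) * Complex.I_sq
  rw [h1, h2, ← Complex.ofReal_exp, ← Complex.ofReal_mul, ← Complex.ofReal_mul, ← mul_assoc]
  congr 2
  have hp : √Real.pi * √Real.pi = Real.pi := Real.mul_self_sqrt Real.pi_pos.le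
  have hp0 : √Real.pi ≠ 0 := by positivity
  have h20 : √2 ≠ (0 : ℝ) := by positivity
  nth_rewrite 2 [← hp]
  field_simp

lemma memLp_vacuum : MemLp vacuumFun 2 volume ∧ eLpNorm vacuumFun 2 volume = 1 := by
  have hcont : Continuous vacuumFun := by
    unfold vacuumFun
    fun_prop
  have hsq : ∀ x : U 1, ‖vacuumFun x‖ₑ ^ (2 : ℝ)
      = ENNReal.ofReal ((√Real.pi)⁻¹ * Real.exp (-1 * (x 0).1 ^ 2)) *
        ENNReal.ofReal ((√Real.pi)⁻¹ * Real.exp (-1 * (x 0).2 ^ 2)) := by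
    intro x
    rw [← ofReal_norm, vacuumFun, Complex.norm_real, Real.norm_of_nonneg (by positivity),
      ENNReal.ofReal_rpow_of_nonneg (by positivity) (by norm_num),
      ← ENNReal.ofReal_mul (by positivity)]
    congr 1
    rw [Real.rpow_two, mul_pow, ← Real.exp_nat_mul, mul_mul_mul_comm, ← Real.exp_add, sq]
    congr 2
    push_cast
    ring
  have hG : ∫⁻ t : ℝ, ENNReal.ofReal ((√Real.pi)⁻¹ * Real.exp (-1 * t ^ 2)) = 1 := by
    rw [← ofReal_integral_eq_lintegral_ofReal
      ((integrable_exp_neg_mul_sq (by norm_num)).const_mul _)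
      (Filter.Eventually.of_forall fun t => by positivity), integral_const_mul, integral_gaussian,
      div_one, inv_mul_cancel₀ (by positivity), ENNReal.ofReal_one]
  have hmeas : Measurable fun t : ℝ => ENNReal.ofReal ((√Real.pi)⁻¹ * Real.exp (-1 * t ^ 2)) := by
    fun_prop
  have key : ∫⁻ x : U 1, ‖vacuumFun x‖ₑ ^ (2 : ℝ) = 1 := by
    simp_rw [hsq]
    have hp := volume_preserving_funUnique (Fin 1) (ℝ × ℝ)
    have := hp.lintegral_comp (f := fun p : ℝ × ℝ =>
      ENNReal.ofReal ((√Real.pi)⁻¹ * Real.exp (-1 * p.1 ^ 2)) *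
        ENNReal.ofReal ((√Real.pi)⁻¹ * Real.exp (-1 * p.2 ^ 2)))
      ((hmeas.comp measurable_fst).mul (hmeas.comp measurable_snd))
    rw [Measure.volume_eq_prod, lintegral_prod_mul hmeas.aemeasurable hmeas.aemeasurable, hG,
      one_mul] at this
    exact this
  have hn : eLpNorm vacuumFun 2 volume = 1 := by
    rw [eLpNorm_eq_lintegral_rpow_enorm_toReal (by norm_num) (by norm_num), ENNReal.toReal_ofNat,
      key, ENNReal.one_rpow]
  exact ⟨⟨hcont.aestronglyMeasurable, by rw [hn]; exact ENNReal.one_lt_top⟩, hn⟩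

/-- The lowest weight vector `Ω ∈ L²(U_1)`. -/
def vacuum : L2U 1 := memLp_vacuum.1.toLp _

lemma norm_vacuum : ‖vacuum‖ = 1 := by
  rw [vacuum, Lp.norm_toLp, memLp_vacuum.2, ENNReal.toReal_one]

/-- The rank one projection `P = Ω ⊗ Ω^*` onto the line spanned by the lowest weight vector. -/
def vacuumProj : L2U 1 →L[ℂ] L2U 1 := InnerProductSpace.rankOne ℂ vacuum vacuum

/-- The isometry `φ ↦ φ ⊗ Ω` of `L²(U_N)` into `L²(U_{N+1})`. -/
def tensorVacuum (N : ℕ) : L2U N →ₗᵢ[ℂ] L2U (N + 1) where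
  toFun φ := tensor φ vacuum
  map_add' φ φ' := by
    ext1
    filter_upwards [tensor_coe (φ + φ') vacuum, tensor_coe φ vacuum, tensor_coe φ' vacuum,
      Lp.coeFn_add (tensor φ vacuum) (tensor φ' vacuum),
      (fstPart_quasi N 1).ae (Lp.coeFn_add φ φ')] with x h1 h2 h3 h4 h5
    rw [h1, h4, Pi.add_apply, h2, h3, h5, Pi.add_apply, add_mul]
  map_smul' c φ := by
    ext1
    filter_upwards [tensor_coe (c • φ) vacuum, tensor_coe φ vacuum,
      Lp.coeFn_smul c (tensor φ vacuum),
      (fstPart_quasi N 1).ae (Lp.coeFn_smul c φ)] with x h1 h2 h3 h4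
    rw [h1, RingHom.id_apply, h3, Pi.smul_apply, h2, h4, Pi.smul_apply, smul_eq_mul, smul_eq_mul,
      mul_assoc]
  norm_map' φ := by
    change ‖tensor φ vacuum‖ = ‖φ‖
    rw [norm_tensor, norm_vacuum, mul_one]

/-- The Hilbert space `L²(ΩT_0)`: the inductive limit of `L²(U_0) → L²(U_1) → ⋯` along
`φ ↦ φ ⊗ Ω`. -/
abbrev L2Loop : Type := HilbertLimit tensorVacuum

/-- The canonical isometry `L²(U_N) → L²(ΩT_0)`. -/
def toL2Loop (N : ℕ) : L2U N →ₗᵢ[ℂ] L2Loop := toHilbertLimit tensorVacuum N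

end TwistedCrossed

end

open TwistedCrossed

universe w

noncomputable section

namespace TwistedCrossed

/-! ### Rank one operators and closed subspaces of operators -/

section RankOne

variable {H : Type*} [NormedAddCommGroup H] [InnerProductSpace ℂ H] [CompleteSpace H]

/-! In the standard representation an element `f` of `C_c(U_N, C_0(U_N))` acts on `L²(U_N)` by the
integral kernel `f(x - y)(x) τ(x - y, x)`. Solving for the kernel `φ(x) conj ψ(y)`, with `φ`, `ψ`
continuous of compact support, gives an explicit element `matrixElt φ ψ` that acts as the rank one
operator `φ ⊗ ψ^*` (`integrated_matrixElt`). The cocycle identity shows that these elements multiply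
like rank one operators already in the convolution algebra (`conv_matrixElt`), hence in every
covariant representation.

Their span is dense in the crossed product (`dense_span_matrixElt`): the universal norm is at most
the `L¹`-norm, and after a cutoff Stone-Weierstrass approximates a kernel by sums of products. By
continuity `e a e'` is, for matrix elements `e`, `e'` and arbitrary `a`, a matrix element multiplied
by a matrix coefficient of `Φ(a)` (`matrixElt_mul_mul`). So `Φ(a) = 0` forces `b a c = 0` for all
`b`, `c`, and then `a = 0`. This proves that the standard representation is faithful on the full
crossed product without classifying the covariant representations. A faithful representation is
isometric, so its range is closed. It consists of compact operators and contains `φ ⊗ ψ^*` for a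
dense set of vectors, hence it is all of `𝒦(L²(U_N))`.

If `V φ = φ ⊗ Ω`, then `V^*(φ ⊗ ψ) = ⟪Ω, ψ⟫ φ`, so `V T V^* = T ⊗ P`. The connecting maps are
therefore conjugation by `V`, transported through `Φ`. Elementary tensors are total, so the formula
on them determines the operator.

For the limit, vectors from the finite stages are dense in the Hilbert space limit, so the compact
operators coming from the finite stages are dense in all compact operators. A C⋆-algebra that
receives compatible injective maps with dense union of ranges is the inductive limit: the
homomorphism required by the universal property is the closure of its graph over the dense part. -/

lemma isCompactOperator_rankOne (x y : H) :
    IsCompactOperator (InnerProductSpace.rankOne ℂ x y : H →L[ℂ] H) :=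
  IsCompactOperator.clm_comp (isCompactOperator_of_locallyCompactSpace_dom (innerSL ℂ y))
    (ContinuousLinearMap.toSpanSingleton ℂ x)

/-- A closed subspace of operators which contains the rank one operators `x ⊗ y^*` for `x`, `y` in
a dense set contains all rank one operators. -/
lemma rankOne_mem_of_dense {D : Set H} (hD : Dense D) {R : Submodule ℂ (H →L[ℂ] H)}
    (hR : IsClosed (R : Set (H →L[ℂ] H)))
    (h : ∀ x ∈ D, ∀ y ∈ D, InnerProductSpace.rankOne ℂ x y ∈ R) (x y : H) :
    InnerProductSpace.rankOne ℂ x y ∈ R := by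
  -- `x ⊗ y^*` is continuous in each variable separately: density is used first for `y` with `x` in
  -- `D`, then for `x`.
  have h1 : ∀ x ∈ D, ∀ y, InnerProductSpace.rankOne ℂ x y ∈ R := fun x hx y =>
    (hR.preimage (InnerProductSpace.rankOne ℂ x).continuous).closure_subset_iff.2
      (fun y hy => h x hx y hy) (hD y)
  exact (hR.preimage ((InnerProductSpace.rankOne ℂ).continuous.eval_const y)).closure_subset_iff.2
    (fun x hx => h1 x hx y) (hD x)

/-- A closed subspace of operators which contains the rank one operators `x ⊗ y^*` for `x`, `y` in
a dense set contains all compact operators. -/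
lemma compact_mem_of_rankOne {D : Set H} (hD : Dense D) {R : Submodule ℂ (H →L[ℂ] H)}
    (hR : IsClosed (R : Set (H →L[ℂ] H)))
    (h : ∀ x ∈ D, ∀ y ∈ D, InnerProductSpace.rankOne ℂ x y ∈ R) {T : H →L[ℂ] H}
    (hT : IsCompactOperator T) : T ∈ R := by
  have hr := rankOne_mem_of_dense hD hR h
  rw [← SetLike.mem_coe, ← hR.closure_eq, Metric.mem_closure_iff]
  intro ε hε
  have htb := (hT.isCompact_closure_image_closedBall 1).totallyBounded.subset subset_closure
  rw [Metric.totallyBounded_iff] at htb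
  -- The projection onto the span `W` of a finite `ε/2`-net of the image of the unit ball moves each
  -- `T x` with `‖x‖ = 1` by at most `ε/2`, since it is at least as close as the nearest point of
  -- the net.
  obtain ⟨t, htf, hcov⟩ := htb (ε / 2) (by positivity)
  have : FiniteDimensional ℂ (Submodule.span ℂ t) := FiniteDimensional.span_of_finite ℂ htf
  set W := Submodule.span ℂ t
  let b := stdOrthonormalBasis ℂ W
  refine ⟨W.starProjection ∘L T, ?_, ?_⟩
  -- Expansion of the projection in an orthonormal basis of `W`, with `T` moved to the second vector
  -- as its adjoint.
  · have e : W.starProjection ∘L T = ∑ i, InnerProductSpace.rankOne ℂ (b i : H)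
        (ContinuousLinearMap.adjoint T (b i : H)) := by
      ext x
      simp only [ContinuousLinearMap.comp_apply, sum_apply,
        InnerProductSpace.rankOne_apply, ContinuousLinearMap.adjoint_inner_left]
      rw [Submodule.starProjection_apply, b.orthogonalProjectionOnto_apply_eq_sum]
      simp
    rw [e]
    exact R.sum_mem fun i _ => hr _ _
  · rw [dist_eq_norm]
    refine lt_of_le_of_lt ?_ (half_lt_self hε)
    refine ContinuousLinearMap.opNorm_le_of_unit_norm (by positivity) fun x hx => ?_
    obtain ⟨y, hy, hxy⟩ := Set.mem_iUnion₂.1 (hcov ⟨x, by simp [hx], rfl⟩)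
    have h1 := W.starProjection_minimal (T x)
    have h2 : ‖T x - W.starProjection (T x)‖ ≤ ‖T x - y‖ := by
      rw [h1]
      exact ciInf_le ⟨0, by rintro _ ⟨_, rfl⟩; exact norm_nonneg _⟩
        (⟨y, Submodule.subset_span hy⟩ : W)
    exact h2.trans (by rw [← dist_eq_norm]; exact le_of_lt hxy)

end RankOne

/-! ### A criterion for inductive limits of C⋆-algebras -/

section Limit

universe u v

/-- A C⋆-algebra `L` with compatible injective `*`-homomorphisms `A n → L` whose ranges have dense
union is the inductive limit of the sequence `A n`. -/
lemma isCStarInductiveLimit_of_dense {A : ℕ → Type u} [∀ n, NonUnitalCStarAlgebra (A n)]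
    {i : ∀ n, A n →⋆ₙₐ[ℂ] A (n + 1)} {L : Type v} [NonUnitalCStarAlgebra L]
    {j : ∀ n, A n →⋆ₙₐ[ℂ] L} (hij : ∀ n a, j (n + 1) (i n a) = j n a)
    (hj : ∀ n, Function.Injective (j n)) (hd : Dense (⋃ n, Set.range (j n))) :
    IsCStarInductiveLimit.{u, v, w} A i L j := by
  refine ⟨hij, fun B _ k hk => ?_⟩
  -- Elements of different stages can be moved to a common stage without changing their images in
  -- `L` and `B`, so sums and products can be formed there.
  have hlift : ∀ n (a : A n) m, n ≤ m → ∃ b : A m, j m b = j n a ∧ k m b = k n a := by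
    intro n a m hm
    induction m, hm using Nat.le_induction with
    | base => exact ⟨a, rfl, rfl⟩
    | succ m hm ih =>
      obtain ⟨b, h1, h2⟩ := ih
      exact ⟨i m b, by rw [hij, h1], by rw [hk, h2]⟩
  -- The graph, over the union of the ranges, of the homomorphism to be constructed.
  let Γ : NonUnitalStarSubalgebra ℂ (L × B) :=
    { carrier := {p | ∃ n, ∃ a : A n, p = (j n a, k n a)}
      add_mem' := by
        rintro _ _ ⟨n, a, rfl⟩ ⟨m, b, rfl⟩
        obtain ⟨a', h1, h2⟩ := hlift n a (max n m) (le_max_left _ _)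
        obtain ⟨b', h3, h4⟩ := hlift m b (max n m) (le_max_right _ _)
        exact ⟨_, a' + b', by simp [h1, h2, h3, h4]⟩
      zero_mem' := ⟨0, 0, Prod.ext (map_zero _).symm (map_zero _).symm⟩
      mul_mem' := by
        rintro _ _ ⟨n, a, rfl⟩ ⟨m, b, rfl⟩
        obtain ⟨a', h1, h2⟩ := hlift n a (max n m) (le_max_left _ _)
        obtain ⟨b', h3, h4⟩ := hlift m b (max n m) (le_max_right _ _)
        exact ⟨_, a' * b', by simp [h1, h2, h3, h4]⟩
      smul_mem' := by
        rintro c _ ⟨n, a, rfl⟩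
        exact ⟨n, c • a, by simp⟩
      star_mem' := by
        rintro _ ⟨n, a, rfl⟩
        exact ⟨n, star a, Prod.ext (map_star _ _).symm (map_star _ _).symm⟩ }
  have : IsClosed (Γ.topologicalClosure : Set (L × B)) := Γ.isClosed_topologicalClosure
  let p : Γ.topologicalClosure →⋆ₙₐ[ℂ] L :=
    (NonUnitalStarAlgHom.fst ℂ L B).comp (NonUnitalStarSubalgebraClass.subtype Γ.topologicalClosure)
  let q : Γ.topologicalClosure →⋆ₙₐ[ℂ] B :=
    (NonUnitalStarAlgHom.snd ℂ L B).comp (NonUnitalStarSubalgebraClass.subtype Γ.topologicalClosure)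
  -- `k n` is contractive and the injective `j n` is isometric. The inequality survives closure, so
  -- the closure of `Γ` is still the graph of a function.
  have hle : ∀ x ∈ Γ.topologicalClosure, ‖x.2‖ ≤ ‖x.1‖ := by
    intro x hx
    have hcl : IsClosed {x : L × B | ‖x.2‖ ≤ ‖x.1‖} :=
      isClosed_le (by fun_prop) (by fun_prop)
    refine hcl.closure_subset_iff.2 ?_ hx
    rintro _ ⟨n, a, rfl⟩
    exact (NonUnitalStarAlgHom.norm_apply_le (k n) a).trans
      (NonUnitalStarAlgHom.norm_map (j n) (hj n) a).ge
  have hpi : Function.Injective p := by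
    rw [injective_iff_map_eq_zero]
    rintro ⟨⟨x, y⟩, hx⟩ (h0 : x = 0)
    have h1 := hle _ hx
    simp only [h0, norm_zero, norm_le_zero_iff] at h1
    exact Subtype.ext (Prod.ext h0 h1)
  have hmem : ∀ n a, (j n a, k n a) ∈ Γ.topologicalClosure := fun n a =>
    subset_closure ⟨n, a, rfl⟩
  -- An injective `*`-homomorphism is isometric and so has closed range; here the range contains the
  -- dense union.
  have hps : Function.Surjective p := by
    have hcl : IsClosed (Set.range p) :=
      (NonUnitalStarAlgHom.isometry p hpi).isClosedEmbedding.isClosed_range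
    rw [← Set.range_eq_univ, ← hcl.closure_eq]
    refine (hd.mono ?_).closure_eq
    rintro _ hx
    obtain ⟨n, a, rfl⟩ := Set.mem_iUnion.1 hx
    exact ⟨⟨_, hmem n a⟩, rfl⟩
  let e := StarAlgEquiv.ofBijective p ⟨hpi, hps⟩
  refine ⟨q.comp (e.symm : L →⋆ₙₐ[ℂ] Γ.topologicalClosure), fun n a => ?_, fun f hf => ?_⟩
  · have : e.symm (j n a) = ⟨_, hmem n a⟩ := by
      rw [StarAlgEquiv.symm_apply_eq]
      rfl
    change q (e.symm (j n a)) = _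
    rw [this]
    rfl
  · have hfc : ∀ g : L →⋆ₙₐ[ℂ] B, Continuous g := fun g =>
      AddMonoidHomClass.continuous_of_bound g 1 (by simpa using NonUnitalStarAlgHom.norm_apply_le g)
    refine DFunLike.coe_injective (Continuous.ext_on hd (hfc _) (hfc _) ?_)
    intro x hx
    obtain ⟨n, a, rfl⟩ := Set.mem_iUnion.1 hx
    have : e.symm (j n a) = ⟨_, hmem n a⟩ := by
      rw [StarAlgEquiv.symm_apply_eq]
      rfl
    change f _ = q (e.symm (j n a))
    rw [this, hf]
    rfl

end Limit

/-! ### Approximation of functions of two variables by sums of products -/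

section ProductApprox

variable {X Y : Type*} [MetricSpace X] [MetricSpace Y]

variable (X Y) in
/-- The span of the products `f(x) g(y)` of continuous functions. -/
def prodSpan : Submodule ℂ (X × Y → ℂ) :=
  Submodule.span ℂ {F | ∃ (f : C(X, ℂ)) (g : C(Y, ℂ)), F = fun p => f p.1 * g p.2}

/-- Together with `prodSpan_star`, this makes the restrictions to a compact set a `*`-algebra, as
Stone-Weierstrass requires. -/
lemma prodSpan_mul {F G : X × Y → ℂ} (hF : F ∈ prodSpan X Y) (hG : G ∈ prodSpan X Y) :
    F * G ∈ prodSpan X Y := by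
  induction hF using Submodule.span_induction with
  | zero => simp
  | add a b _ _ ha hb => rw [add_mul]; exact add_mem ha hb
  | smul c a _ ha => rw [smul_mul_assoc]; exact Submodule.smul_mem _ c ha
  | mem F hF =>
    obtain ⟨f, g, rfl⟩ := hF
    induction hG using Submodule.span_induction with
    | zero => simp
    | add a b _ _ ha hb => rw [mul_add]; exact add_mem ha hb
    | smul c a _ ha => rw [mul_smul_comm]; exact Submodule.smul_mem _ c ha
    | mem G hG =>
      obtain ⟨f', g', rfl⟩ := hG
      refine Submodule.subset_span ⟨f * f', g * g', ?_⟩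
      funext p
      simp only [Pi.mul_apply, ContinuousMap.mul_apply]
      ring

lemma prodSpan_star {F : X × Y → ℂ} (hF : F ∈ prodSpan X Y) : star F ∈ prodSpan X Y := by
  induction hF using Submodule.span_induction with
  | zero => simp
  | add a b _ _ ha hb => rw [star_add]; exact add_mem ha hb
  | smul c a _ ha => rw [star_smul]; exact Submodule.smul_mem _ _ ha
  | mem F hF =>
    obtain ⟨f, g, rfl⟩ := hF
    refine Submodule.subset_span ⟨star f, star g, ?_⟩
    funext p
    simp

/-- Continuous functions on `X × Y` are approximated by sums of products, uniformly on compact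
sets. -/
lemma exists_prodSpan_approx {Z : Set (X × Y)} (hZ : IsCompact Z) {k : X × Y → ℂ}
    (hk : Continuous k) {ε : ℝ} (hε : 0 < ε) :
    ∃ G ∈ prodSpan X Y, ∀ p ∈ Z, ‖k p - G p‖ < ε := by
  have : CompactSpace Z := isCompact_iff_compactSpace.1 hZ
  let S : StarSubalgebra ℂ C(Z, ℂ) :=
    { carrier := {F | ∃ G ∈ prodSpan X Y, ∀ z : Z, F z = G z}
      mul_mem' := by
        rintro F F' ⟨G, hG, h⟩ ⟨G', hG', h'⟩
        exact ⟨G * G', prodSpan_mul hG hG', fun z => by simp [h, h']⟩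
      add_mem' := by
        rintro F F' ⟨G, hG, h⟩ ⟨G', hG', h'⟩
        exact ⟨G + G', add_mem hG hG', fun z => by simp [h, h']⟩
      algebraMap_mem' := fun c =>
        ⟨_, Submodule.subset_span ⟨ContinuousMap.const X c, 1, rfl⟩, fun z => by simp⟩
      star_mem' := by
        rintro F ⟨G, hG, h⟩
        exact ⟨star G, prodSpan_star hG, fun z => by simp [h]⟩ }
  have hS : S.SeparatesPoints := by
    -- Distinct points differ in one coordinate, and the distance to that coordinate of the first
    -- point separates them.
    rintro ⟨⟨x, y⟩, hz⟩ ⟨⟨x', y'⟩, hz'⟩ hne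
    by_cases hx : x = x'
    · have hy : y ≠ y' := fun hy => hne (by simp [hx, hy])
      let g : C(Y, ℂ) := ⟨fun t => (dist t y : ℂ), by fun_prop⟩
      refine ⟨_, ⟨⟨fun z => g z.1.2, by fun_prop⟩,
        ⟨_, Submodule.subset_span ⟨1, g, rfl⟩, fun z => by simp⟩, rfl⟩, ?_⟩
      simpa [g, @eq_comm ℂ 0, @eq_comm Y y'] using hy
    · let f : C(X, ℂ) := ⟨fun t => (dist t x : ℂ), by fun_prop⟩
      refine ⟨_, ⟨⟨fun z => f z.1.1, by fun_prop⟩,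
        ⟨_, Submodule.subset_span ⟨f, 1, rfl⟩, fun z => by simp⟩, rfl⟩, ?_⟩
      simpa [f, @eq_comm ℂ 0, @eq_comm X x'] using hx
  have htop := ContinuousMap.starSubalgebra_topologicalClosure_eq_top_of_separatesPoints S hS
  let F : C(Z, ℂ) := ⟨fun z => k z.1, by fun_prop⟩
  have hF : F ∈ S.topologicalClosure := by rw [htop]; trivial
  obtain ⟨F', ⟨G, hG, h⟩, hd⟩ := Metric.mem_closure_iff.1 hF ε hε
  refine ⟨G, hG, fun p hp => ?_⟩
  rw [← h ⟨p, hp⟩, ← dist_eq_norm]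
  exact lt_of_le_of_lt (ContinuousMap.dist_apply_le_dist (f := F) (g := F') ⟨p, hp⟩) hd

variable [LocallyCompactSpace X] [LocallyCompactSpace Y]

/-- A compactly supported cutoff function which is `1` on a given compact set. -/
lemma exists_cutoff {K : Set X} (hK : IsCompact K) :
    ∃ χ : C_c(X, ℂ), (∀ x ∈ K, χ x = 1) ∧ ∀ x, ‖χ x‖ ≤ 1 ∧ ‖1 - χ x‖ ≤ 1 := by
  obtain ⟨f, h1, -, hc, h01⟩ := exists_continuous_one_zero_of_isCompact hK isClosed_empty
    (Set.disjoint_empty K)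
  refine ⟨⟨⟨fun x => (f x : ℂ), by fun_prop⟩, hc.comp_left Complex.ofReal_zero⟩,
    fun x hx => ?_, fun x => ?_⟩
  · change ((f x : ℝ) : ℂ) = 1
    rw [h1 hx]
    simp
  · obtain ⟨ha, hb⟩ := h01 x
    change ‖((f x : ℝ) : ℂ)‖ ≤ 1 ∧ ‖1 - ((f x : ℝ) : ℂ)‖ ≤ 1
    constructor
    · rw [Complex.norm_real, Real.norm_of_nonneg ha]
      exact hb
    · rw [← Complex.ofReal_one, ← Complex.ofReal_sub, Complex.norm_real,
        Real.norm_of_nonneg (by linarith)]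
      linarith

variable (X Y) in
/-- The span of the products `φ(x) ψ(y)` of compactly supported continuous functions. -/
def compactProdSpan : Submodule ℂ (X × Y → ℂ) :=
  Submodule.span ℂ {F | ∃ (φ : C_c(X, ℂ)) (ψ : C_c(Y, ℂ)), F = fun p => φ p.1 * ψ p.2}

/-- Compactly supported continuous functions on `X × Y` are uniformly approximated by sums of
products, with supports in a fixed compact set. -/
lemma exists_compactProdSpan_approx {k : X × Y → ℂ} (hk : Continuous k)
    (hc : HasCompactSupport k) :
    ∃ (K : Set X) (L : Set Y), IsCompact K ∧ IsCompact L ∧ tsupport k ⊆ K ×ˢ L ∧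
      ∀ ε > 0, ∃ G ∈ compactProdSpan X Y, (∀ p, ‖k p - G p‖ ≤ ε) ∧ ∀ p ∉ K ×ˢ L, G p = 0 := by
  -- The cutoffs are `1` on the two projections of the support of `k`, so `k = χ η k`, and
  -- multiplying an approximant by `χ η` does not increase the error. The compact sets `tsupport χ`
  -- and `tsupport η` do not depend on `ε`; this later turns uniform errors into `L¹` and `L²`
  -- errors.
  obtain ⟨χ, hχ1, hχ⟩ := exists_cutoff (hc.isCompact.image continuous_fst)
  obtain ⟨η, hη1, hη⟩ := exists_cutoff (hc.isCompact.image continuous_snd)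
  have hout : ∀ p ∉ tsupport χ ×ˢ tsupport η, χ p.1 * η p.2 = 0 := by
    intro p hp
    rw [Set.mem_prod, not_and_or] at hp
    rcases hp with hp | hp
    · rw [image_eq_zero_of_notMem_tsupport hp, zero_mul]
    · rw [image_eq_zero_of_notMem_tsupport hp, mul_zero]
  have hkχ : ∀ p, χ p.1 * η p.2 * k p = k p := by
    intro p
    by_cases hp : p ∈ tsupport k
    · rw [hχ1 _ ⟨p, hp, rfl⟩, hη1 _ ⟨p, hp, rfl⟩, one_mul, one_mul]
    · rw [image_eq_zero_of_notMem_tsupport hp, mul_zero]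
  have hsub : tsupport k ⊆ tsupport χ ×ˢ tsupport η := by
    refine closure_minimal (fun p hp => ?_) ((isClosed_tsupport _).prod (isClosed_tsupport _))
    by_contra h
    exact hp (by rw [← hkχ, hout p h, zero_mul])
  refine ⟨tsupport χ, tsupport η, χ.hasCompactSupport, η.hasCompactSupport, hsub, fun ε hε => ?_⟩
  obtain ⟨G, hG, h⟩ := exists_prodSpan_approx
    (χ.hasCompactSupport.isCompact.prod η.hasCompactSupport.isCompact) hk hε
  refine ⟨fun p => χ p.1 * η p.2 * G p, ?_, fun p => ?_, fun p hp => by simp only [hout p hp, zero_mul]⟩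
  · clear h
    induction hG using Submodule.span_induction with
    | zero =>
      simp only [Pi.zero_apply, mul_zero]
      exact (compactProdSpan X Y).zero_mem
    | add a b _ _ ha hb =>
      simp only [Pi.add_apply, mul_add]
      exact add_mem ha hb
    | smul c a _ ha =>
      simp only [Pi.smul_apply, mul_smul_comm]
      exact Submodule.smul_mem _ c ha
    | mem F hF =>
      obtain ⟨f, g, rfl⟩ := hF
      refine Submodule.subset_span
        ⟨⟨⟨fun x => χ x * f x, χ.continuous.mul f.continuous⟩, χ.hasCompactSupport.mul_right⟩,
          ⟨⟨fun y => η y * g y, η.continuous.mul g.continuous⟩, η.hasCompactSupport.mul_right⟩, ?_⟩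
      funext p
      change χ p.1 * η p.2 * (f p.1 * g p.2) = χ p.1 * f p.1 * (η p.2 * g p.2)
      ring
  · by_cases hp : p ∈ tsupport χ ×ˢ tsupport η
    · rw [← hkχ p, ← mul_sub, norm_mul, norm_mul]
      calc ‖χ p.1‖ * ‖η p.2‖ * ‖k p - G p‖ ≤ 1 * 1 * ε := by
            gcongr
            · exact (hχ _).1
            · exact (hη _).1
            · exact (h p hp).le
        _ = ε := by ring
    · rw [← hkχ p]
      simpa only [hout p hp, zero_mul, sub_zero, norm_zero] using hε.le

end ProductApprox

/-! ### Linearity and the `L¹` bound for the map into the crossed product -/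

section General

variable {G A : Type} [AddCommGroup G] [TopologicalSpace G] [IsTopologicalAddGroup G]
  [LocallyCompactSpace G] [SecondCountableTopology G] [T2Space G] [MeasureSpace G] [BorelSpace G]
  [(volume : Measure G).IsAddHaarMeasure] [NonUnitalCStarAlgebra A]

namespace TwistedDynamics

variable (S : TwistedDynamics G A)

lemma convIntegrand_integrable (f₁ f₂ : C_c(G, A)) (g : G) :
    Integrable (S.convIntegrand f₁ f₂ g) :=
  ((S.convIntegrand_continuous f₁ f₂).comp
    (Continuous.prodMk_right g)).integrable_of_hasCompactSupport
    (HasCompactSupport.intro f₁.hasCompactSupport.isCompact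
      fun h hh => S.convIntegrand_eq_zero f₁ f₂ g h hh)

lemma CovRep.inner_integrated {S : TwistedDynamics G A} (r : CovRep S) (f : C_c(G, A))
    (v w : r.H) : inner ℂ w (r.integrated f v) = ∫ g, inner ℂ w (r.π (f g) (r.ρ g v)) := by
  rw [CovRep.integrated_apply]
  exact (integral_inner (r.integrand_integrable f v) w).symm

lemma ι_add (f₁ f₂ : C_c(G, A)) : S.ι (f₁ + f₂) = S.ι f₁ + S.ι f₂ := by
  refine Subtype.ext ?_
  ext1; funext r; exact r.integrated_add f₁ f₂

lemma ι_smul (c : ℂ) (f : C_c(G, A)) : S.ι (c • f) = c • S.ι f := by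
  refine Subtype.ext ?_
  ext1; funext r; exact r.integrated_smul c f

lemma ι_zero : S.ι 0 = 0 := by
  refine Subtype.ext ?_
  ext1; funext r; exact r.integrated_zero

/-- The bound holds in each covariant representation, hence for the supremum. It reduces density in
the crossed product to approximation in `L¹`. -/
lemma norm_ι_le (f : C_c(G, A)) : ‖S.ι f‖ ≤ ∫ g, ‖f g‖ :=
  lp.norm_le_of_forall_le (integral_nonneg fun _ => norm_nonneg _) fun r =>
    r.norm_integrated_le f

/-- The representation of the crossed product which integrates a covariant representation. -/
def CovRep.integratedHom {S : TwistedDynamics G A} (r : CovRep S) :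
    S.CrossedProduct →⋆ₙₐ[ℂ] (r.H →L[ℂ] r.H) where
  toFun a := (a : S.universalRange.topologicalClosure).1 r
  map_smul' _ _ := rfl
  map_zero' := rfl
  map_add' _ _ := rfl
  map_mul' _ _ := rfl
  map_star' _ := rfl

end TwistedDynamics

end General

/-! ### Elements of the convolution algebra that represent rank one operators -/

section MatrixUnits

variable {N : ℕ}

lemma C0_norm_le {f : C₀(U N, ℂ)} {C : ℝ} (hC : 0 ≤ C) (h : ∀ x, ‖f x‖ ≤ C) : ‖f‖ ≤ C :=
  (BoundedContinuousFunction.norm_le (f := f.toBCF) hC).2 h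

/-- Evaluation at a point, as a continuous functional on `C_0(U_N)`. -/
def evalC0 (x : U N) : C₀(U N, ℂ) →L[ℂ] ℂ :=
  LinearMap.mkContinuous
    { toFun := fun f => f x
      map_add' := fun _ _ => rfl
      map_smul' := fun _ _ => rfl } 1 fun f => by
    rw [one_mul]
    exact f.toBCF.norm_coe_le_norm x

/-- A compactly supported function of two variables, as a `C_0`-valued function of the first. -/
def curryC0 (F : C_c(U N × U N, ℂ)) : C_c(U N, C₀(U N, ℂ)) where
  toFun g :=
    { toFun := fun x => F (g, x)
      continuous_toFun := by fun_prop
      zero_at_infty' := by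
        refine HasCompactSupport.is_zero_at_infty ?_
        refine HasCompactSupport.intro (F.hasCompactSupport.isCompact.image continuous_snd) ?_
        intro x hx
        exact image_eq_zero_of_notMem_tsupport fun h => hx ⟨_, h, rfl⟩ }
  continuous_toFun := by
    have huc := F.hasCompactSupport.uniformContinuous_of_continuous F.continuous
    rw [Metric.continuous_iff]
    intro g₀ ε hε
    obtain ⟨δ, hδ, h⟩ := Metric.uniformContinuous_iff.1 huc (ε / 2) (by positivity)
    refine ⟨δ, hδ, fun g hg => ?_⟩
    rw [dist_eq_norm]
    refine lt_of_le_of_lt (C0_norm_le (by positivity) fun x => ?_) (half_lt_self hε)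
    have := h (a := (g, x)) (b := (g₀, x)) (by simpa [Prod.dist_eq] using hg)
    rw [dist_eq_norm] at this
    exact this.le
  hasCompactSupport' := by
    refine HasCompactSupport.intro (F.hasCompactSupport.isCompact.image continuous_fst) ?_
    intro g hg
    ext x
    exact image_eq_zero_of_notMem_tsupport (f := F) (x := (g, x)) fun h => hg ⟨_, h, rfl⟩

/-- The element of `C_c(U_N, C_0(U_N))` representing the rank one operator `φ ⊗ ψ^*`. -/
def matrixElt (φ ψ : C_c(U N, ℂ)) : C_c(U N, C₀(U N, ℂ)) :=
  curryC0
    -- The standard representation sends `f` to the operator `ξ ↦ ∫ f(g)(x) τ(g, x) ξ(x - g) dg`.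
    -- The conjugate phase cancels `τ(g, x)`, and with `y = x - g` the kernel becomes `φ(x) conj
    -- ψ(y)`.
    { toFun := fun p => φ p.2 * (starRingEnd ℂ (ψ (p.2 - p.1)) * starRingEnd ℂ (tau p.1 p.2 : ℂ))
      continuous_toFun := by
        have h1 : Continuous fun p : U N × U N => ψ (p.2 - p.1) := ψ.continuous.comp (by fun_prop)
        exact (φ.continuous.comp continuous_snd).mul ((Complex.continuous_conj.comp h1).mul
          (Complex.continuous_conj.comp tau_coe_continuous))
      hasCompactSupport' := by
        -- If `x` is in the support of `φ` and `x - g` in that of `ψ`, then `g = x - (x - g)` lies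
        -- in the difference of the two supports.
        refine HasCompactSupport.intro
          ((IsCompact.add φ.hasCompactSupport ψ.hasCompactSupport.isCompact.neg).prod
            φ.hasCompactSupport.isCompact) ?_
        rintro ⟨g, x⟩ h
        by_cases hx : x ∈ tsupport φ
        · by_cases hg : x - g ∈ tsupport ψ
          · refine absurd (Set.mk_mem_prod ?_ hx) h
            simpa using Set.add_mem_add hx (Set.neg_mem_neg.2 hg)
          · simp [image_eq_zero_of_notMem_tsupport hg]
        · simp [image_eq_zero_of_notMem_tsupport hx] }

lemma matrixElt_apply (φ ψ : C_c(U N, ℂ)) (g x : U N) :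
    matrixElt φ ψ g x
      = φ x * (starRingEnd ℂ (ψ (x - g)) * starRingEnd ℂ (tau g x : ℂ)) := rfl

lemma tau_conj_mul (g x : U N) : (starRingEnd ℂ) (tau g x : ℂ) * (tau g x : ℂ) = 1 := by
  rw [← Complex.normSq_eq_conj_mul_self]; simp

/-- The conjugate of `tau_mul_tau` for the pair `h`, `g - h`. It merges the three phases occurring
in a convolution of matrix elements into the single phase of the product, independent of `h`. -/
lemma tau_conv (g h x : U N) :
    (tau h (g - h) : ℂ) * ((starRingEnd ℂ) (tau h x : ℂ) *
      (starRingEnd ℂ) (tau (g - h) (x - h) : ℂ)) = (starRingEnd ℂ) (tau g x : ℂ) := by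
  have h1 := tau_mul_tau h (g - h) x
  rw [add_sub_cancel] at h1
  have h2 := congrArg (starRingEnd ℂ) h1
  rw [map_mul, map_mul] at h2
  rw [mul_comm ((starRingEnd ℂ) (tau h x : ℂ)), h2, ← mul_assoc, mul_comm (tau h (g - h) : ℂ),
    tau_conj_mul, one_mul]

/-- The elements `matrixElt φ ψ` multiply like the rank one operators `φ ⊗ ψ^*`. -/
lemma conv_matrixElt (φ ψ φ' ψ' : C_c(U N, ℂ)) :
    (loopSystem N).conv (matrixElt φ ψ) (matrixElt φ' ψ')
      = (∫ y, starRingEnd ℂ (ψ y) * φ' y) • matrixElt φ ψ' := by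
  ext g x
  have hi := (loopSystem N).convIntegrand_integrable (matrixElt φ ψ) (matrixElt φ' ψ') g
  change evalC0 x (∫ h, (loopSystem N).convIntegrand (matrixElt φ ψ) (matrixElt φ' ψ') g h) =
    (∫ y, starRingEnd ℂ (ψ y) * φ' y) * (matrixElt φ ψ' g x)
  -- Evaluation at `x` is a continuous functional and passes under the `C_0`-valued integral; the
  -- scalar factor then appears through `y = x - h`.
  rw [← ContinuousLinearMap.integral_comp_comm _ hi,
    ← integral_sub_left_eq_self (fun y => starRingEnd ℂ (ψ y) * φ' y) volume x,
    ← integral_mul_const]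
  refine integral_congr_ae (Filter.Eventually.of_forall fun h => ?_)
  change (tau h (g - h) : ℂ) * (matrixElt φ ψ h x * matrixElt φ' ψ' (g - h) (x - h)) =
    starRingEnd ℂ (ψ (x - h)) * φ' (x - h) * matrixElt φ ψ' g x
  rw [matrixElt_apply, matrixElt_apply, matrixElt_apply, ← tau_conv g h x, sub_sub_sub_cancel_right]
  ring

/-- The class in `L²(U_N)` of a compactly supported continuous function. -/
def ccToL2 (φ : C_c(U N, ℂ)) : L2U N :=
  (φ.continuous.memLp_of_hasCompactSupport φ.hasCompactSupport : MemLp φ 2 volume).toLp φ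

lemma ccToL2_coe (φ : C_c(U N, ℂ)) : ccToL2 φ =ᵐ[volume] φ := MemLp.coeFn_toLp _

lemma denseRange_ccToL2 : DenseRange (ccToL2 (N := N)) := by
  refine (Lp.dense_hasCompactSupport_contDiff (μ := (volume : Measure (U N))) (F := ℂ)
    (p := 2) (by norm_num)).mono ?_
  rintro f ⟨g, hfg, hc, hg⟩
  refine ⟨⟨⟨g, hg.continuous⟩, hc⟩, ?_⟩
  ext1
  exact (ccToL2_coe _).trans hfg.symm

lemma inner_ccToL2 (φ ψ : C_c(U N, ℂ)) :
    inner ℂ (ccToL2 φ) (ccToL2 ψ) = ∫ y, starRingEnd ℂ (φ y) * ψ y := by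
  rw [L2.inner_def]
  refine integral_congr_ae ?_
  filter_upwards [ccToL2_coe φ, ccToL2_coe ψ] with y h1 h2
  rw [h1, h2, RCLike.inner_apply, mul_comm]

/-- The standard representation maps `matrixElt φ ψ` to the rank one operator `φ ⊗ ψ^*`. -/
lemma integrated_matrixElt (φ ψ : C_c(U N, ℂ)) :
    (stdRep N).integrated (matrixElt φ ψ)
      = InnerProductSpace.rankOne ℂ (ccToL2 φ) (ccToL2 ψ) := by
  -- Both sides are bounded, so it is enough to compare matrix coefficients between compactly
  -- supported continuous functions. There the double integrand is continuous with compact support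
  -- and the integrals may be interchanged.
  refine DFunLike.coe_injective (denseRange_ccToL2.equalizer (by fun_prop) (by fun_prop) ?_)
  funext ξ
  refine denseRange_ccToL2.eq_of_inner_right ℂ fun η => ?_
  change inner ℂ (ccToL2 η) ((stdRep N).integrated (matrixElt φ ψ) (ccToL2 ξ)) = inner ℂ (ccToL2 η)
    (InnerProductSpace.rankOne ℂ (ccToL2 φ) (ccToL2 ψ) (ccToL2 ξ))
  have hL : inner ℂ (ccToL2 η) ((stdRep N).integrated (matrixElt φ ψ) (ccToL2 ξ))
      = ∫ g, ∫ x, starRingEnd ℂ (η x) * φ x * (starRingEnd ℂ (ψ (x - g)) * ξ (x - g)) := by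
    refine ((stdRep N).inner_integrated (matrixElt φ ψ) (ccToL2 ξ) (ccToL2 η)).trans ?_
    congr 1
    funext g
    refine (L2.inner_def _ _).trans (integral_congr_ae ?_)
    filter_upwards [ccToL2_coe η, mulRep_coe (matrixElt φ ψ g) (twUnitary g (ccToL2 ξ)),
      twUnitary_coe g (ccToL2 ξ), ae_sub g (ccToL2_coe ξ)] with x h1 h2 h3 h4
    change inner ℂ _ ((mulRep N (matrixElt φ ψ g) (twUnitary g (ccToL2 ξ)) : U N → ℂ) x) = _
    rw [h1, h2, h3, h4, RCLike.inner_apply, matrixElt_apply]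
    linear_combination (φ x * starRingEnd ℂ (ψ (x - g)) * ξ (x - g) * starRingEnd ℂ (η x)) *
      tau_conj_mul g x
  rw [hL, integral_integral_swap_of_hasCompactSupport, InnerProductSpace.rankOne_apply,
    inner_smul_right, inner_ccToL2, inner_ccToL2, ← integral_const_mul]
  · congr 1
    funext x
    rw [integral_const_mul,
      integral_sub_left_eq_self (fun y => starRingEnd ℂ (ψ y) * ξ y) volume x, mul_comm]
  · have h1 : Continuous fun p : U N × U N => ψ (p.2 - p.1) := ψ.continuous.comp (by fun_prop)
    have h2 : Continuous fun p : U N × U N => ξ (p.2 - p.1) := ξ.continuous.comp (by fun_prop)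
    exact ((Complex.continuous_conj.comp (η.continuous.comp continuous_snd)).mul
      (φ.continuous.comp continuous_snd)).mul ((Complex.continuous_conj.comp h1).mul h2)
  · refine HasCompactSupport.intro
      ((IsCompact.add φ.hasCompactSupport ψ.hasCompactSupport.isCompact.neg).prod φ.hasCompactSupport) ?_
    rintro ⟨g, x⟩ h
    by_cases hx : x ∈ tsupport φ
    · by_cases hg : x - g ∈ tsupport ψ
      · refine absurd (Set.mk_mem_prod ?_ hx) h
        simpa using Set.add_mem_add hx (Set.neg_mem_neg.2 hg)
      · simp [Function.uncurry, image_eq_zero_of_notMem_tsupport hg]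
    · simp [Function.uncurry, image_eq_zero_of_notMem_tsupport hx]

/-! ### Density of the span of the matrix elements -/

/-- Compactly supported functions with values in `C_0(U_N)` are uniformly small off a compact
subset of `U_N`. -/
lemma exists_cutoff_C0 (f : C_c(U N, C₀(U N, ℂ))) {ε : ℝ} (hε : 0 < ε) :
    ∃ χ : C_c(U N, ℂ), ∀ g x, ‖f g x - χ x * f g x‖ ≤ ε := by
  -- The range of `f` is compact in `C_0(U_N)`, so it has a finite `ε/2`-net. Each member is below
  -- `ε/2` off a compact set, and `χ` is `1` on the union of these finitely many sets.
  have htb := (f.hasCompactSupport.isCompact_range f.continuous).totallyBounded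
  rw [Metric.totallyBounded_iff] at htb
  obtain ⟨t, htf, hcov⟩ := htb (ε / 2) (by positivity)
  have hK : ∀ a : C₀(U N, ℂ), ∃ K : Set (U N), IsCompact K ∧ ∀ x ∉ K, ‖a x‖ < ε / 2 := by
    intro a
    have h := (Metric.tendsto_nhds.1 a.zero_at_infty') (ε / 2) (by positivity)
    obtain ⟨K, hK, hK'⟩ := Filter.mem_cocompact.1 h
    exact ⟨K, hK, fun x hx => by simpa using hK' hx⟩
  choose K hKc hK using hK
  obtain ⟨χ, h1, h2⟩ := exists_cutoff (htf.isCompact_biUnion fun a _ => hKc a)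
  refine ⟨χ, fun g x => ?_⟩
  have e : f g x - χ x * f g x = (1 - χ x) * f g x := by ring
  rw [e, norm_mul]
  by_cases hx : x ∈ ⋃ a ∈ t, K a
  · rw [h1 x hx, sub_self, norm_zero, zero_mul]
    exact hε.le
  · obtain ⟨a, ha, hfa⟩ := Set.mem_iUnion₂.1 (hcov ⟨g, rfl⟩)
    have h3 := hK a x fun h => hx (Set.mem_iUnion₂.2 ⟨a, ha, h⟩)
    have h4 : ‖f g x - a x‖ ≤ ‖f g - a‖ := (f g - a).toBCF.norm_coe_le_norm x
    rw [Metric.mem_ball, dist_eq_norm] at hfa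
    have h5 : ‖f g x‖ ≤ ‖f g x - a x‖ + ‖a x‖ := by
      simpa using norm_add_le (f g x - a x) (a x)
    calc ‖1 - χ x‖ * ‖f g x‖ ≤ 1 * ε := by
          gcongr
          · exact (h2 x).2
          · linarith
      _ = ε := one_mul ε

variable (N) in
/-- The span of the elements `matrixElt φ ψ`. -/
def matrixSpan : Submodule ℂ C_c(U N, C₀(U N, ℂ)) :=
  Submodule.span ℂ {f | ∃ φ ψ, f = matrixElt φ ψ}

/-- Functions in `compactProdSpan` are integral kernels of elements of `matrixSpan`. -/
lemma exists_matrixSpan_of_kernel {G : U N × U N → ℂ} (hG : G ∈ compactProdSpan (U N) (U N)) :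
    ∃ f ∈ matrixSpan N, ∀ g x, f g x = G (x, x - g) * starRingEnd ℂ (tau g x : ℂ) := by
  induction hG using Submodule.span_induction with
  | zero => exact ⟨0, zero_mem _, fun g x => by simp⟩
  | add a b _ _ ha hb =>
    obtain ⟨f, hf, h⟩ := ha
    obtain ⟨f', hf', h'⟩ := hb
    exact ⟨f + f', add_mem hf hf', fun g x => by simp [h, h', add_mul]⟩
  | smul c a _ ha =>
    obtain ⟨f, hf, h⟩ := ha
    exact ⟨c • f, Submodule.smul_mem _ c hf, fun g x => by simp [h, mul_assoc]⟩
  | mem F hF =>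
    obtain ⟨φ, ψ, rfl⟩ := hF
    -- `matrixElt` conjugates its second argument, hence the `star`.
    refine ⟨matrixElt φ (star ψ), Submodule.subset_span ⟨_, _, rfl⟩, fun g x => ?_⟩
    rw [matrixElt_apply]
    simp [mul_assoc]

/-- The kernel `χ(x) f(x - y)(x) τ(x - y, x)` of a cut off element of `C_c(U_N, C_0(U_N))`. -/
lemma cutoff_kernel (χ : C_c(U N, ℂ)) (f : C_c(U N, C₀(U N, ℂ))) :
    Continuous (fun p : U N × U N => χ p.1 * f (p.1 - p.2) p.1 * (tau (p.1 - p.2) p.1 : ℂ)) ∧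
      HasCompactSupport
        (fun p : U N × U N => χ p.1 * f (p.1 - p.2) p.1 * (tau (p.1 - p.2) p.1 : ℂ)) := by
  constructor
  · have h1 : Continuous fun p : U N × U N => (f (p.1 - p.2)).toBCF :=
      ZeroAtInftyContinuousMap.isometry_toBCF.continuous.comp (f.continuous.comp (by fun_prop))
    have h2 : Continuous fun p : U N × U N => (f (p.1 - p.2)).toBCF p.1 :=
      h1.eval continuous_fst
    have h3 : Continuous fun p : U N × U N => (tau (p.1 - p.2) p.1 : ℂ) :=
      tau_coe_continuous.comp (f := fun p : U N × U N => (p.1 - p.2, p.1)) (by fun_prop)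
    exact ((χ.continuous.comp continuous_fst).mul h2).mul h3
  · refine HasCompactSupport.intro (χ.hasCompactSupport.isCompact.prod
      (IsCompact.add χ.hasCompactSupport f.hasCompactSupport.isCompact.neg)) ?_
    rintro ⟨x, y⟩ h
    by_cases hx : x ∈ tsupport χ
    · by_cases hg : x - y ∈ tsupport f
      · refine absurd (Set.mk_mem_prod hx ?_) h
        simpa using Set.add_mem_add hx (Set.neg_mem_neg.2 hg)
      · simp [image_eq_zero_of_notMem_tsupport hg]
    · simp [image_eq_zero_of_notMem_tsupport hx]

open scoped Pointwise in
/-- Elements of `C_c(U_N, C_0(U_N))` are approximated by `matrixSpan` in the `L¹`-norm. -/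
lemma exists_matrixSpan_approx (f : C_c(U N, C₀(U N, ℂ))) {ε : ℝ} (hε : 0 < ε) :
    ∃ f' ∈ matrixSpan N, ∫ g, ‖f g - f' g‖ ≤ ε := by
  have hS : IsCompact (tsupport f) := f.hasCompactSupport
  set a := (volume : Measure (U N)).real (tsupport f) with ha
  have ha0 : 0 ≤ a := measureReal_nonneg
  -- A uniform error on a set of volume `a` contributes at most `ε/2` to the integral; the `+ 1`
  -- covers volume zero.
  obtain ⟨χ, hχ⟩ := exists_cutoff_C0 f (ε := ε / 2 / (a + 1)) (by positivity)
  obtain ⟨K, L, hK, hL, hkKL, happ⟩ :=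
    exists_compactProdSpan_approx (cutoff_kernel χ f).1 (cutoff_kernel χ f).2
  set k : U N × U N → ℂ :=
    fun p => χ p.1 * f (p.1 - p.2) p.1 * (tau (p.1 - p.2) p.1 : ℂ) with hk
  -- For `g` outside `K - L` no point `(x, x - g)` lies in `K × L`, so the kernel and its
  -- approximant both vanish there. As `K` and `L` are already fixed, the accuracy of `G` may depend
  -- on the volume `b`.
  have hQ : IsCompact (K + -L) := hK.add hL.neg
  set b := (volume : Measure (U N)).real (K + -L) with hb
  have hb0 : 0 ≤ b := measureReal_nonneg
  obtain ⟨G, hG, hkG, hG0⟩ := happ (ε / 2 / (b + 1)) (by positivity)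
  obtain ⟨f', hf', hfG⟩ := exists_matrixSpan_of_kernel hG
  refine ⟨f', hf', ?_⟩
  have hpt : ∀ g, ‖f g - f' g‖ ≤ (tsupport f).indicator (fun _ => ε / 2 / (a + 1)) g +
      (K + -L).indicator (fun _ => ε / 2 / (b + 1)) g := by
    intro g
    have hi1 : 0 ≤ (tsupport f).indicator (fun _ => ε / 2 / (a + 1)) g :=
      Set.indicator_nonneg (fun _ _ => by positivity) g
    have hi2 : 0 ≤ (K + -L).indicator (fun _ => ε / 2 / (b + 1)) g :=
      Set.indicator_nonneg (fun _ _ => by positivity) g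
    refine C0_norm_le (by positivity) fun x => ?_
    -- The cutoff error plus the error of the kernel at `(x, x - g)`.
    have e : (f g - f' g) x = (f g x - χ x * f g x) +
        (k (x, x - g) - G (x, x - g)) * starRingEnd ℂ (tau g x : ℂ) := by
      change f g x - f' g x = _
      rw [hfG, hk]
      simp only [sub_sub_cancel]
      linear_combination (-(χ x * f g x)) * tau_conj_mul g x
    rw [e]
    refine (norm_add_le _ _).trans (add_le_add ?_ ?_)
    · by_cases hg : g ∈ tsupport f
      · rw [Set.indicator_of_mem hg]
        exact hχ g x
      · rw [image_eq_zero_of_notMem_tsupport hg]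
        simpa using hi1
    · rw [norm_mul, RCLike.norm_conj, Circle.norm_coe, mul_one]
      by_cases hg : g ∈ K + -L
      · rw [Set.indicator_of_mem hg]
        exact hkG _
      · have hn : (x, x - g) ∉ K ×ˢ L := by
          rintro ⟨h1, h2⟩
          refine hg ?_
          simpa using Set.add_mem_add h1 (Set.neg_mem_neg.2 h2)
        rw [hG0 _ hn, image_eq_zero_of_notMem_tsupport fun h => hn (hkKL h)]
        simpa using hi2
  have hI1 : Integrable ((tsupport f).indicator fun _ : U N => ε / 2 / (a + 1)) :=
    (integrable_indicator_iff hS.measurableSet).2 (integrableOn_const hS.measure_lt_top.ne)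
  have hI2 : Integrable ((K + -L).indicator fun _ : U N => ε / 2 / (b + 1)) :=
    (integrable_indicator_iff hQ.measurableSet).2 (integrableOn_const hQ.measure_lt_top.ne)
  calc ∫ g, ‖f g - f' g‖ ≤ ∫ g, ((tsupport f).indicator (fun _ => ε / 2 / (a + 1)) g +
        (K + -L).indicator (fun _ => ε / 2 / (b + 1)) g) :=
        integral_mono_of_nonneg (Filter.Eventually.of_forall fun _ => norm_nonneg _)
          (hI1.add hI2) (Filter.Eventually.of_forall hpt)
    _ = a * (ε / 2 / (a + 1)) + b * (ε / 2 / (b + 1)) := by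
        rw [integral_add hI1 hI2, integral_indicator_const _ hS.measurableSet,
          integral_indicator_const _ hQ.measurableSet, smul_eq_mul, smul_eq_mul]
    _ ≤ ε / 2 + ε / 2 := by
        refine add_le_add ?_ ?_
        · rw [mul_div_assoc', div_le_iff₀ (by positivity)]
          nlinarith
        · rw [mul_div_assoc', div_le_iff₀ (by positivity)]
          nlinarith
    _ = ε := add_halves ε

/-- The elements `matrixElt φ ψ` have dense span in the crossed product. -/
lemma dense_span_matrixElt :
    Dense (Submodule.span ℂ {a : (loopSystem N).CrossedProduct |
      ∃ φ ψ, a = (loopSystem N).ι (matrixElt φ ψ)} : Set (loopSystem N).CrossedProduct) := by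
  refine dense_closure.1 ((loopSystem N).denseRange_ι.mono ?_)
  rintro _ ⟨f, rfl⟩
  rw [Metric.mem_closure_iff]
  intro ε hε
  obtain ⟨f', hf', h⟩ := exists_matrixSpan_approx f (half_pos hε)
  refine ⟨(loopSystem N).ι f', ?_, ?_⟩
  · clear h
    induction hf' using Submodule.span_induction with
    | zero =>
      rw [TwistedDynamics.ι_zero]
      exact Submodule.zero_mem _
    | add a b _ _ ha hb => rw [TwistedDynamics.ι_add]; exact add_mem ha hb
    | smul c a _ ha => rw [TwistedDynamics.ι_smul]; exact Submodule.smul_mem _ c ha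
    | mem F hF =>
      obtain ⟨φ, ψ, rfl⟩ := hF
      exact Submodule.subset_span ⟨φ, ψ, rfl⟩
  · have e : (loopSystem N).ι f - (loopSystem N).ι f' = (loopSystem N).ι (f - f') := by
      rw [sub_eq_iff_eq_add, ← TwistedDynamics.ι_add, sub_add_cancel]
    rw [dist_eq_norm, e]
    exact lt_of_le_of_lt (((loopSystem N).norm_ι_le _).trans h) (half_lt_self hε)

/-! ### The standard representation is faithful, with range the compact operators -/

variable (N) in
/-- The representation of the crossed product on `L²(U_N)`. -/
def stdHom : (loopSystem N).CrossedProduct →⋆ₙₐ[ℂ] (L2U N →L[ℂ] L2U N) :=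
  (stdRep N).integratedHom

lemma stdHom_ι (f : C_c(U N, C₀(U N, ℂ))) :
    stdHom N ((loopSystem N).ι f) = (stdRep N).integrated f := rfl

lemma stdHom_continuous : Continuous (stdHom N) :=
  AddMonoidHomClass.continuous_of_bound (stdHom N) 1
    (by simpa using NonUnitalStarAlgHom.norm_apply_le (stdHom N))

/-- Sandwiching between matrix units only depends on the image in the standard representation. -/
lemma matrixElt_mul_mul (φ ψ φ' ψ' : C_c(U N, ℂ)) (a : (loopSystem N).CrossedProduct) :
    (loopSystem N).ι (matrixElt φ ψ) * a * (loopSystem N).ι (matrixElt φ' ψ')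
      = (inner ℂ (ccToL2 ψ) (stdHom N a (ccToL2 φ')) : ℂ) •
        (loopSystem N).ι (matrixElt φ ψ') := by
  have hc := stdHom_continuous (N := N)
  -- Both sides are linear and continuous in `a`. For `a = matrixElt α β`, each equals `⟪ψ, α⟫ ⟪β,
  -- φ'⟫` times the element of `φ`, `ψ'`.
  refine congrFun (Continuous.ext_on dense_span_matrixElt
    (f := fun a => (loopSystem N).ι (matrixElt φ ψ) * a * (loopSystem N).ι (matrixElt φ' ψ'))
    (g := fun a => (inner ℂ (ccToL2 ψ) (stdHom N a (ccToL2 φ')) : ℂ) •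
        (loopSystem N).ι (matrixElt φ ψ')) (by fun_prop) (by fun_prop) ?_) a
  intro a ha
  simp only
  induction ha using Submodule.span_induction with
  | zero => simp
  | add x y _ _ hx hy =>
    rw [mul_add, add_mul, hx, hy, map_add, add_apply, inner_add_right, add_smul]
  | smul c x _ hx =>
    rw [mul_smul_comm, smul_mul_assoc, hx, map_smul, smul_apply, inner_smul_right, mul_smul]
  | mem x hx =>
    obtain ⟨α, β, rfl⟩ := hx
    rw [← TwistedDynamics.ι_conv, conv_matrixElt, TwistedDynamics.ι_smul, smul_mul_assoc,
      ← TwistedDynamics.ι_conv, conv_matrixElt, TwistedDynamics.ι_smul, smul_smul, stdHom_ι,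
      integrated_matrixElt, InnerProductSpace.rankOne_apply, inner_smul_right, inner_ccToL2,
      inner_ccToL2, mul_comm]

/-- The standard representation of the crossed product is faithful. -/
lemma stdHom_injective : Function.Injective (stdHom N) := by
  rw [injective_iff_map_eq_zero]
  intro x hx
  -- Between two matrix elements `x` contributes only a coefficient of its image, which is zero.
  -- Density then frees the left factor, and afterwards the right one.
  have h1 : ∀ φ' ψ' a, a * x * (loopSystem N).ι (matrixElt φ' ψ') = 0 := by
    intro φ' ψ' a
    refine congrFun (Continuous.ext_on dense_span_matrixElt
      (f := fun a => a * x * (loopSystem N).ι (matrixElt φ' ψ')) (g := fun _ => 0)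
      (by fun_prop) (by fun_prop) ?_) a
    intro a ha
    simp only
    induction ha using Submodule.span_induction with
    | zero => simp
    | add x y _ _ hx hy => rw [add_mul, add_mul, hx, hy, add_zero]
    | smul c x _ hx => rw [smul_mul_assoc, smul_mul_assoc, hx, smul_zero]
    | mem y hy =>
      obtain ⟨φ, ψ, rfl⟩ := hy
      rw [matrixElt_mul_mul, hx, zero_apply, inner_zero_right, zero_smul]
  have h2 : ∀ a b, a * x * b = 0 := by
    intro a b
    refine congrFun (Continuous.ext_on dense_span_matrixElt
      (f := fun b => a * x * b) (g := fun _ => 0) (by fun_prop) (by fun_prop) ?_) b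
    intro b hb
    simp only
    induction hb using Submodule.span_induction with
    | zero => simp
    | add x y _ _ hx hy => rw [mul_add, hx, hy, add_zero]
    | smul c x _ hx => rw [mul_smul_comm, hx, smul_zero]
    | mem y hy =>
      obtain ⟨φ, ψ, rfl⟩ := hy
      exact h1 φ ψ a
  -- The case `a = b = x^*` gives `x^* x x^* = 0`, hence `(x^* x)^* (x^* x) = 0`. The C⋆-identity
  -- applied twice yields `x = 0`.
  have h3 : star x * x = 0 := by
    rw [← CStarRing.star_mul_self_eq_zero_iff, star_mul, star_star, ← mul_assoc, h2, zero_mul]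
  exact CStarRing.star_mul_self_eq_zero_iff x |>.1 h3

lemma stdHom_mem_compactOps (a : (loopSystem N).CrossedProduct) :
    stdHom N a ∈ compactOps (L2U N) := by
  have hcl : IsClosed {T : L2U N →L[ℂ] L2U N | T ∈ compactOps (L2U N)} :=
    (inferInstance : IsClosed (compactOps (L2U N) : Set (L2U N →L[ℂ] L2U N)))
  refine (hcl.preimage stdHom_continuous).closure_subset_iff.2 ?_ (dense_span_matrixElt a)
  intro a ha
  change stdHom N a ∈ compactOps (L2U N)
  induction ha using Submodule.span_induction with
  | zero => rw [map_zero]; exact zero_mem _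
  | add x y _ _ hx hy => rw [map_add]; exact add_mem hx hy
  | smul c x _ hx => rw [map_smul]; exact SMulMemClass.smul_mem c hx
  | mem y hy =>
    obtain ⟨φ, ψ, rfl⟩ := hy
    rw [stdHom_ι, integrated_matrixElt]
    exact isCompactOperator_rankOne _ _

/-- Faithfulness makes the representation isometric, so its range is closed. It contains the rank
one operators of a dense set of vectors, and these generate all compact operators. -/
lemma stdHom_surjOn {T : L2U N →L[ℂ] L2U N} (hT : IsCompactOperator T) : ∃ a, stdHom N a = T := by
  refine compact_mem_of_rankOne (R := LinearMap.range
    (stdHom N : (loopSystem N).CrossedProduct →ₗ[ℂ] (L2U N →L[ℂ] L2U N))) denseRange_ccToL2 ?_ ?_ hT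
  · rw [LinearMap.coe_range]
    exact (NonUnitalStarAlgHom.isometry _ stdHom_injective).isClosedEmbedding.isClosed_range
  · rintro _ ⟨φ, rfl⟩ _ ⟨ψ, rfl⟩
    exact ⟨(loopSystem N).ι (matrixElt φ ψ), integrated_matrixElt φ ψ⟩

variable (N) in
/-- The isomorphism of the crossed product with the compact operators on `L²(U_N)`. -/
def crossedProductEquiv : (loopSystem N).CrossedProduct ≃⋆ₐ[ℂ] compactOps (L2U N) :=
  StarAlgEquiv.ofBijective
    (NonUnitalStarAlgHom.codRestrict (stdHom N) (compactOps (L2U N)) stdHom_mem_compactOps)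
    ⟨fun _ _ h => stdHom_injective (congrArg Subtype.val h), fun T => by
      obtain ⟨a, ha⟩ := stdHom_surjOn T.2
      exact ⟨a, Subtype.ext ha⟩⟩

end MatrixUnits

/-! ### Elementary tensors and conjugation by the vacuum embedding -/

section Tensor

variable {M N : ℕ}

lemma inner_tensor (φ φ' : L2U M) (ψ ψ' : L2U N) :
    inner ℂ (tensor φ ψ) (tensor φ' ψ') = inner ℂ φ φ' * (inner ℂ ψ ψ' : ℂ) := by
  have hi : Integrable (fun p : U M × U N => (inner ℂ (φ p.1) (φ' p.1) : ℂ) *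
      inner ℂ (ψ p.2) (ψ' p.2)) (volume.prod volume) :=
    (L2.integrable_inner φ φ').mul_prod (L2.integrable_inner ψ ψ')
  rw [L2.inner_def, L2.inner_def, L2.inner_def, ← integral_prod_mul,
    ← (measurePreserving_parts M N).map_eq, integral_map (measurePreserving_parts M N).aemeasurable
      (by rw [(measurePreserving_parts M N).map_eq]; exact hi.aestronglyMeasurable)]
  refine integral_congr_ae ?_
  filter_upwards [tensor_coe φ ψ, tensor_coe φ' ψ'] with z h1 h2
  rw [h1, h2]
  simp only [RCLike.inner_apply, map_mul]
  ring

lemma tensor_smul_right (c : ℂ) (φ : L2U M) (ψ : L2U N) :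
    tensor φ (c • ψ) = c • tensor φ ψ := by
  ext1
  filter_upwards [tensor_coe φ (c • ψ), tensor_coe φ ψ, Lp.coeFn_smul c (tensor φ ψ),
    (sndPart_quasi M N).ae (Lp.coeFn_smul c ψ)] with x h1 h2 h3 h4
  rw [h1, h3, Pi.smul_apply, h2, h4, Pi.smul_apply, smul_eq_mul, smul_eq_mul, mul_left_comm]

variable (M N) in
/-- The span of the elementary tensors in `L²(U_{M+N})`. -/
def tensorSpan : Submodule ℂ (L2U (M + N)) :=
  Submodule.span ℂ {χ | ∃ (φ : L2U M) (ψ : L2U N), χ = tensor φ ψ}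

/-- Passes from sums of products of functions, defined pointwise, to classes in `L²`. -/
lemma exists_tensorSpan_coe {G : U M × U N → ℂ} (hG : G ∈ compactProdSpan (U M) (U N)) :
    ∃ t ∈ tensorSpan M N, t =ᵐ[volume] fun z => G (fstPart z, sndPart z) := by
  induction hG using Submodule.span_induction with
  | zero => exact ⟨0, zero_mem _, Lp.coeFn_zero ℂ 2 volume⟩
  | add a b _ _ ha hb =>
    obtain ⟨s, hs, h⟩ := ha
    obtain ⟨t, ht, h'⟩ := hb
    refine ⟨s + t, add_mem hs ht, ?_⟩
    filter_upwards [Lp.coeFn_add s t, h, h'] with z h1 h2 h3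
    rw [h1, Pi.add_apply, h2, h3, Pi.add_apply]
  | smul c a _ ha =>
    obtain ⟨s, hs, h⟩ := ha
    refine ⟨c • s, Submodule.smul_mem _ c hs, ?_⟩
    filter_upwards [Lp.coeFn_smul c s, h] with z h1 h2
    rw [h1, Pi.smul_apply, h2, Pi.smul_apply]
  | mem F hF =>
    obtain ⟨φ, ψ, rfl⟩ := hF
    refine ⟨tensor (ccToL2 φ) (ccToL2 ψ), Submodule.subset_span ⟨_, _, rfl⟩, ?_⟩
    filter_upwards [tensor_coe (ccToL2 φ) (ccToL2 ψ), (fstPart_quasi M N).ae (ccToL2_coe φ),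
      (sndPart_quasi M N).ae (ccToL2_coe ψ)] with z h1 h2 h3
    rw [h1, h2, h3]

variable (M N) in
/-- Splitting `U_{M+N}` as `U_M × U_N`. -/
def partsHomeo : U (M + N) ≃ₜ U M × U N where
  toFun z := (fstPart z, sndPart z)
  invFun p := Fin.append p.1 p.2
  left_inv z := by
    funext k
    refine Fin.addCases (fun i => ?_) (fun i => ?_) k
    · simp [fstPart]
    · simp [sndPart]
  right_inv p := by
    refine Prod.ext (funext fun i => ?_) (funext fun i => ?_)
    · simp [fstPart]
    · simp [sndPart]
  continuous_toFun := by
    unfold fstPart sndPart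
    fun_prop
  continuous_invFun := by
    refine continuous_pi fun k => ?_
    refine Fin.addCases (fun i => ?_) (fun i => ?_) k
    · simp only [Fin.append_left]
      fun_prop
    · simp only [Fin.append_right]
      fun_prop

/-- Elementary tensors are total in `L²(U_{M+N})`. -/
lemma dense_tensorSpan : Dense (tensorSpan M N : Set (L2U (M + N))) := by
  refine dense_closure.1 (denseRange_ccToL2.mono ?_)
  rintro _ ⟨k, rfl⟩
  obtain ⟨K, L, hK, hL, hkKL, happ⟩ := exists_compactProdSpan_approx
    (k.continuous.comp (partsHomeo M N).symm.continuous)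
    (k.hasCompactSupport.comp_homeomorph (partsHomeo M N).symm)
  have hQ : IsCompact (partsHomeo M N ⁻¹' (K ×ˢ L)) :=
    (partsHomeo M N).isCompact_preimage.2 (hK.prod hL)
  -- The square root of the volume of a compact set outside which `k` and all approximants vanish:
  -- the factor between a uniform error and an `L²` error.
  set c : ℝ≥0∞ := (volume (partsHomeo M N ⁻¹' (K ×ˢ L))) ^ (1 / (2 : ℝ≥0∞).toReal) with hc
  have hc_top : c ≠ ∞ := ENNReal.rpow_ne_top_of_nonneg (by positivity) hQ.measure_lt_top.ne
  rw [Metric.mem_closure_iff]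
  intro ε hε
  obtain ⟨G, hG, hkG, hG0⟩ := happ (ε / 2 / (c.toReal + 1)) (by positivity)
  obtain ⟨t, ht, htG⟩ := exists_tensorSpan_coe hG
  refine ⟨t, ht, lt_of_le_of_lt ?_ (half_lt_self hε)⟩
  have h1 : eLpNorm ((k : U (M + N) → ℂ) - fun z => G (partsHomeo M N z)) 2 volume
      ≤ ENNReal.ofReal (ε / 2 / (c.toReal + 1)) * c := by
    refine eLpNorm_sub_le_of_dist_bdd volume (by norm_num) hQ.measurableSet (by positivity)
      (fun z => ?_) (fun z hz => ?_) (fun z hz => ?_)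
    · rw [dist_eq_norm]
      simpa using hkG (partsHomeo M N z)
    · refine hkKL (subset_tsupport _ ?_)
      simpa using hz
    · by_contra h
      exact hz (hG0 _ h)
  have h2 : eLpNorm (ccToL2 k - t : L2U (M + N)) 2 volume
      = eLpNorm ((k : U (M + N) → ℂ) - fun z => G (partsHomeo M N z)) 2 volume := by
    refine eLpNorm_congr_ae ?_
    filter_upwards [Lp.coeFn_sub (ccToL2 k) t, ccToL2_coe k, htG] with z e1 e2 e3
    rw [e1, Pi.sub_apply, e2, e3]
    rfl
  rw [dist_eq_norm, Lp.norm_def, h2]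
  refine (ENNReal.toReal_mono (ENNReal.mul_ne_top ENNReal.ofReal_ne_top hc_top) h1).trans ?_
  rw [ENNReal.toReal_mul, ENNReal.toReal_ofReal (by positivity), div_mul_eq_mul_div,
    div_le_iff₀ (by positivity)]
  nlinarith [ENNReal.toReal_nonneg (a := c)]

/-- Operators on `L²(U_{M+N})` are determined by their values on elementary tensors. -/
lemma clm_ext_tensor {S T : L2U (M + N) →L[ℂ] L2U (M + N)}
    (h : ∀ (φ : L2U M) (ψ : L2U N), S (tensor φ ψ) = T (tensor φ ψ)) : S = T := by
  refine DFunLike.coe_injective (Continuous.ext_on dense_tensorSpan S.continuous T.continuous ?_)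
  intro x hx
  refine LinearMap.eqOn_span (f := S.toLinearMap) (g := T.toLinearMap) ?_ hx
  rintro _ ⟨φ, ψ, rfl⟩
  exact h φ ψ

/-- Pairing with `v` gives `⟪v ⊗ Ω, φ ⊗ ψ⟫ = ⟪v, φ⟫ ⟪Ω, ψ⟫`. The factor `⟪Ω, ψ⟫` is the source of
the projection `P`. -/
lemma adjoint_tensorVacuum (φ : L2U N) (ψ : L2U 1) :
    ContinuousLinearMap.adjoint (tensorVacuum N).toContinuousLinearMap (tensor φ ψ)
      = (inner ℂ vacuum ψ : ℂ) • φ := by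
  refine ext_inner_left ℂ fun v => ?_
  rw [ContinuousLinearMap.adjoint_inner_right, inner_smul_right]
  refine (inner_tensor v φ vacuum ψ).trans (mul_comm _ _)

/-- Conjugation by `φ ↦ φ ⊗ Ω` is `T ↦ T ⊗ P`. -/
lemma compactConj_tensorVacuum (T : compactOps (L2U N)) (φ : L2U N) (ψ : L2U 1) :
    (compactConj (tensorVacuum N) T : L2U (N + 1) →L[ℂ] L2U (N + 1)) (tensor φ ψ)
      = tensor ((T : L2U N →L[ℂ] L2U N) φ) (vacuumProj ψ) := by
  change tensorVacuum N ((T : L2U N →L[ℂ] L2U N)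
    (ContinuousLinearMap.adjoint (tensorVacuum N).toContinuousLinearMap (tensor φ ψ))) = _
  rw [adjoint_tensorVacuum, map_smul, map_smul, vacuumProj, InnerProductSpace.rankOne_apply,
    tensor_smul_right]
  rfl

end Tensor

/-! ### Conjugation of compact operators by isometries -/

section Conjugation

variable {H K L : Type*} [NormedAddCommGroup H] [InnerProductSpace ℂ H] [CompleteSpace H]
  [NormedAddCommGroup K] [InnerProductSpace ℂ K] [CompleteSpace K]
  [NormedAddCommGroup L] [InnerProductSpace ℂ L] [CompleteSpace L]

/-- Since `V^* V = 1`, the values of `V T V^*` on the range of `V` recover `T`. -/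
lemma compactConj_injective (V : H →ₗᵢ[ℂ] K) : Function.Injective (compactConj V) := by
  rw [injective_iff_map_eq_zero]
  intro T hT
  ext x
  have h : ContinuousLinearMap.adjoint V.toContinuousLinearMap (V x) = x :=
    ext_inner_left ℂ fun z => by
      rw [ContinuousLinearMap.adjoint_inner_right]
      exact V.inner_map_map z x
  have h1 : V ((T : H →L[ℂ] H) (ContinuousLinearMap.adjoint V.toContinuousLinearMap (V x))) = 0 :=
    DFunLike.congr_fun (congrArg Subtype.val hT) (V x)
  rw [h] at h1
  exact (map_eq_zero_iff V V.injective).1 h1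

/-- Functoriality of conjugation. The composite is a third isometry `X` given pointwise, so that
`toHilbertLimit_succ` applies directly and yields compatibility with the connecting maps. -/
lemma compactConj_compactConj {V : H →ₗᵢ[ℂ] K} {W : K →ₗᵢ[ℂ] L} {X : H →ₗᵢ[ℂ] L}
    (h : ∀ x, W (V x) = X x) (T : compactOps H) :
    compactConj W (compactConj V T) = compactConj X T := by
  ext y
  have h1 : ContinuousLinearMap.adjoint V.toContinuousLinearMap
      (ContinuousLinearMap.adjoint W.toContinuousLinearMap y)
      = ContinuousLinearMap.adjoint X.toContinuousLinearMap y :=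
    ext_inner_left ℂ fun z => by
      simp only [ContinuousLinearMap.adjoint_inner_right]
      change inner ℂ (W (V z)) y = inner ℂ (X z) y
      rw [h]
  change W (V ((T : H →L[ℂ] H) (ContinuousLinearMap.adjoint V.toContinuousLinearMap
      (ContinuousLinearMap.adjoint W.toContinuousLinearMap y)))) =
    X ((T : H →L[ℂ] H) (ContinuousLinearMap.adjoint X.toContinuousLinearMap y))
  rw [h1, h]

/-- Shows that a rank one operator on the limit built from two vectors of one stage already comes
from that stage. -/
lemma compactConj_rankOne (V : H →ₗᵢ[ℂ] K) (x y : H) :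
    (compactConj V ⟨_, isCompactOperator_rankOne x y⟩ : K →L[ℂ] K)
      = InnerProductSpace.rankOne ℂ (V x) (V y) := by
  ext z
  change V ((inner ℂ y (ContinuousLinearMap.adjoint V.toContinuousLinearMap z) : ℂ) • x) =
    (inner ℂ (V y) z : ℂ) • V x
  rw [map_smul, ContinuousLinearMap.adjoint_inner_right]
  rfl

end Conjugation

/-! ### Compact operators on a Hilbert space inductive limit -/

section HilbertLimit

variable {E : ℕ → Type} [∀ n, NormedAddCommGroup (E n)] [∀ n, InnerProductSpace ℂ (E n)]
  [∀ n, CompleteSpace (E n)] (V : ∀ n, E n →ₗᵢ[ℂ] E (n + 1))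

/-- The compact operators on a Hilbert space inductive limit are generated by those on the
terms of the sequence. -/
lemma dense_range_compactConj :
    Dense (⋃ n, Set.range (compactConj (toHilbertLimit V n))) := by
  let R : ℕ → Submodule ℂ (HilbertLimit V →L[ℂ] HilbertLimit V) := fun n =>
    LinearMap.range (((NonUnitalStarSubalgebraClass.subtype (compactOps (HilbertLimit V))).comp
      (compactConj (toHilbertLimit V n)) : compactOps (E n) →ₗ[ℂ] _))
  -- Monotonicity makes the supremum of the `R n` their union. With `hE`, it also lets two vectors
  -- of different stages be taken from a common stage.
  have hR : Monotone R := monotone_nat_of_le_succ fun n => by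
    rintro _ ⟨T, rfl⟩
    exact ⟨compactConj (V n) T,
      congrArg Subtype.val (compactConj_compactConj (toHilbertLimit_succ V n) T)⟩
  have hE : Monotone fun n => Set.range (toHilbertLimit V n) := monotone_nat_of_le_succ fun n => by
    rintro _ ⟨x, rfl⟩
    exact ⟨V n x, toHilbertLimit_succ V n x⟩
  intro T
  have hT : (T : HilbertLimit V →L[ℂ] HilbertLimit V) ∈ (⨆ n, R n).topologicalClosure := by
    refine compact_mem_of_rankOne (dense_range_toHilbertLimit V)
      (Submodule.isClosed_topologicalClosure _) ?_ T.2
    intro x hx y hy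
    obtain ⟨n, hx⟩ := Set.mem_iUnion.1 hx
    obtain ⟨m, hy⟩ := Set.mem_iUnion.1 hy
    obtain ⟨x', rfl⟩ := hE (le_max_left n m) hx
    obtain ⟨y', rfl⟩ := hE (le_max_right n m) hy
    refine subset_closure (Submodule.mem_iSup_of_mem (max n m) ?_)
    exact ⟨⟨_, isCompactOperator_rankOne x' y'⟩, compactConj_rankOne _ x' y'⟩
  rw [Metric.mem_closure_iff]
  intro ε hε
  obtain ⟨S, hS, hd⟩ := Metric.mem_closure_iff.1 hT ε hε
  obtain ⟨n, T', rfl⟩ := (Submodule.mem_iSup_of_directed R hR.directed_le).1 hS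
  exact ⟨_, Set.mem_iUnion.2 ⟨n, T', rfl⟩, hd⟩

universe u

/-- If the C⋆-algebras `A n` are isomorphic to the compact operators on `E n`, and the connecting
maps correspond to conjugation by `V n`, then their inductive limit consists of the compact
operators on the Hilbert space inductive limit. -/
lemma isCStarInductiveLimit_compactOps {A : ℕ → Type u} [∀ n, NonUnitalCStarAlgebra (A n)]
    (Φ : ∀ n, A n ≃⋆ₐ[ℂ] compactOps (E n)) (i : ∀ n, A n →⋆ₙₐ[ℂ] A (n + 1))
    (h : ∀ n a, Φ (n + 1) (i n a) = compactConj (V n) (Φ n a)) :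
    IsCStarInductiveLimit.{u, 0, w} A i (compactOps (HilbertLimit V))
      (fun n => (compactConj (toHilbertLimit V n)).comp (Φ n : _ →⋆ₙₐ[ℂ] _)) := by
  refine isCStarInductiveLimit_of_dense (fun n a => ?_) (fun n => ?_) ?_
  · change compactConj (toHilbertLimit V (n + 1)) (Φ (n + 1) (i n a)) =
      compactConj (toHilbertLimit V n) (Φ n a)
    rw [h]
    exact compactConj_compactConj (toHilbertLimit_succ V n) _
  · exact (compactConj_injective _).comp (Φ n).injective
  · refine (dense_range_compactConj V).mono (Set.iUnion_mono fun n => ?_)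
    rintro _ ⟨T, rfl⟩
    obtain ⟨a, rfl⟩ := (Φ n).surjective T
    exact ⟨a, rfl⟩

end HilbertLimit

/-! ### The connecting maps and the main theorem -/

/-- The `*`-homomorphism `A → B` obtained from `C → D` by transport along isomorphisms. -/
def transportHom {A B C D : Type*} [NonUnitalCStarAlgebra A] [NonUnitalCStarAlgebra B]
    [NonUnitalCStarAlgebra C] [NonUnitalCStarAlgebra D] (e : A ≃⋆ₐ[ℂ] C) (e' : B ≃⋆ₐ[ℂ] D)
    (f : C →⋆ₙₐ[ℂ] D) : A →⋆ₙₐ[ℂ] B :=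
  (e'.symm : D →⋆ₙₐ[ℂ] B).comp (f.comp (e : A →⋆ₙₐ[ℂ] C))

lemma apply_transportHom {A B C D : Type*} [NonUnitalCStarAlgebra A] [NonUnitalCStarAlgebra B]
    [NonUnitalCStarAlgebra C] [NonUnitalCStarAlgebra D] (e : A ≃⋆ₐ[ℂ] C) (e' : B ≃⋆ₐ[ℂ] D)
    (f : C →⋆ₙₐ[ℂ] D) (a : A) : e' (transportHom e e' f a) = f (e a) :=
  e'.apply_symm_apply _

/-- The connecting map of the crossed products which corresponds to `T ↦ T ⊗ P`. -/
def connectingHom (N : ℕ) :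
    (loopSystem N).CrossedProduct →⋆ₙₐ[ℂ] (loopSystem (N + 1)).CrossedProduct :=
  transportHom (crossedProductEquiv N) (crossedProductEquiv (N + 1))
    (compactConj (tensorVacuum N))

lemma crossedProductEquiv_connectingHom (N : ℕ) (a : (loopSystem N).CrossedProduct) :
    crossedProductEquiv (N + 1) (connectingHom N a)
      = compactConj (tensorVacuum N) (crossedProductEquiv N a) :=
  apply_transportHom (crossedProductEquiv N) (crossedProductEquiv (N + 1))
    (compactConj (tensorVacuum N)) a

end TwistedCrossed

end

/-- The equivalence, over all operators `T`, expresses `Φ_{N+1}(i_N(a)) = Φ_N(a) ⊗ P` through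
elementary tensors: the image acts in this way, and no other bounded operator does. As `Φ (N + 1)`
is injective, this also makes `i N` unique. -/
theorem mainTheorem8 :
    ∃ Φ : ∀ N : ℕ, (loopSystem N).CrossedProduct ≃⋆ₐ[ℂ] compactOps (L2U N),
      (∀ (N : ℕ) (f : C_c(U N, C₀(U N, ℂ))),
        (Φ N ((loopSystem N).ι f) : L2U N →L[ℂ] L2U N) = (stdRep N).integrated f) ∧
      ∃ i : ∀ N : ℕ,
          (loopSystem N).CrossedProduct →⋆ₙₐ[ℂ] (loopSystem (N + 1)).CrossedProduct,
        (∀ (N : ℕ) (a : (loopSystem N).CrossedProduct) (T : L2U (N + 1) →L[ℂ] L2U (N + 1)),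
          (Φ (N + 1) (i N a) : L2U (N + 1) →L[ℂ] L2U (N + 1)) = T ↔
            ∀ (φ : L2U N) (ψ : L2U 1),
              T (tensor φ ψ) =
                tensor ((Φ N a : L2U N →L[ℂ] L2U N) φ) (vacuumProj ψ)) ∧
        IsCStarInductiveLimit.{1, 0, w} (fun N => (loopSystem N).CrossedProduct) i
          (compactOps L2Loop)
          (fun N => (compactConj (toL2Loop N)).comp (Φ N : _ →⋆ₙₐ[ℂ] _)) := by
  -- The formula for `Φ` on `C_c` is definitional: an element of the crossed product is a family
  -- over all covariant representations, and `Φ` takes its component at `stdRep N`.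
  refine ⟨crossedProductEquiv, fun N f => rfl, connectingHom, fun N a T => ?_, ?_⟩
  · rw [crossedProductEquiv_connectingHom]
    constructor
    · rintro rfl φ ψ
      exact compactConj_tensorVacuum _ φ ψ
    · exact fun h => clm_ext_tensor fun φ ψ => by rw [h, compactConj_tensorVacuum]
  · exact isCStarInductiveLimit_compactOps tensorVacuum crossedProductEquiv connectingHom
      crossedProductEquiv_connectingHom
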